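/- **Setting.** Fix $r$ and $t_1>\dots>t_r>0$. For each $n$ let $p=p(n)$, let $u_1,\dots,u_r\in\mathbb R^p$ be orthonormal (they may depend on $n$), and let $X_j=\sum_{k=1}^r t_k z_{jk}u_k$, $1\le j\le n$. The coefficient vectors $(z_{j1},\dots,z_{jr})$, $1\le j\le n$, are iid over $j$; each $z_{jk}$ has mean zero and unit variance and is sub-Gaussian, with a constant that does not depend on $n$; and $z_{jk},z_{jl}$ are uncorrelated for $k\ne l$, so that the $u_k$ are the principal components of $X_j$. Let $\mathbf X=[X_1,\dots,X_n]/\sqrt n$ and $\mathbf Y=\mathbf X+\mathbf G=[Y_1,\dots,Y_n]/\sqrt n$, where $\mathbf G$ is a $p\times n$ matrix with iid $N(0,1/n)$ entries, independent of $\mathbf X$. No assumption is made on the joint law for different $n$. Let $\hat X_j^{\mathrm{BLP}}=A_jY_j$ be the best linear predictor of $X_j$ from $Y_j$, that is, the linear map $A_j:\mathbb R^p\to\mathbb R^p$ minimizes $\mathbb E\|X_j-A_jY_j\|^2$, and let $\hat{\mathbf X}^{\mathrm{BLP}}=[\hat X_1^{\mathrm{BLP}},\dots,\hat X_n^{\mathrm{BLP}}]/\sqrt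 n$. Let $\mathbf Y=\sum_{k=1}^{\min(p,n)}\hat\sigma_k\hat u_k\hat v_k^T$ be any singular value decomposition of $\mathbf Y$ with decreasing singular values, and for $q=(q_1,\dots,q_r)$ let $\hat{\mathbf X}^{q}=\sum_{k=1}^r q_k\hat u_k\hat v_k^T=[\hat X_1^q,\dots,\hat X_n^q]/\sqrt n$ (terms with $k>\min(p,n)$ are omitted). **Optimal singular values.** For $\gamma,t\ge0$ put $$c=\sqrt{\frac{1-\gamma/t^4}{1+\gamma/t^2}},\qquad \tilde c=\sqrt{\frac{1-\gamma/t^4}{1+1/t^2}}\qquad\text{if } t>\gamma^{1/4},$$ and $c=\tilde c=0$ otherwise, and let $s=\sqrt{1-c^2}$, $\tilde s=\sqrt{1-\tilde c^2}$. The asymptotic operator-norm loss of a component of strength $t$ at aspect ratio $\gamma$ is $$q\mapsto\left\|\begin{pmatrix}t&0\\0&0\end{pmatrix}-q\begin{pmatrix}c\tilde c&c\tilde s\\ s\tilde c&s\tilde s\end{pmatrix}\right\|_{\mathrm{op}},$$ and $q$ is called optimal for $(\gamma,t)$ if it minimizes this function over $\mathbb R$. We take $q^*=(q_1^*,\dots,q_r^*)$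 to be either one of the following: (a) $q_k^*$ is optimal for $(0,t_k)$, where $0=\lim p/n$; (b) for each $n$, with $\gamma_n=p/n$, $q_k^*$ is optimal for $(\gamma_n,\hat t_k)$, where $\hat t_k$ is the estimate of $t_k$ from the observed singular value $\hat\sigma_k$ (with $\hat\sigma_k=0$ if $k>\min(p,n)$), $$\hat t_k=\sqrt{\frac{\hat\sigma_k^2-1-\gamma_n+\sqrt{(\hat\sigma_k^2-1-\gamma_n)^2-4\gamma_n}}{2}}\quad\text{if }\hat\sigma_k>1+\sqrt{\gamma_n},\qquad \hat t_k=0\ \text{ otherwise.}$$ **Theorem.** Suppose $p/n\to0$ as $n\to\infty$. Then, for both choices of $q^*$, almost surely $$\lim_{n\to\infty}\frac1n\sum_{j=1}^n\bigl\|\hat X_j^{q^*}-\hat X_j^{\mathrm{BLP}}\bigr\|^2=\lim_{n\to\infty}\bigl\|\hat{\mathbf X}^{q^*}-\hat{\mathbf X}^{\mathrm{BLP}}\bigr\|_{\mathrm F}^2=0.$$ -/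

import Mathlib

open MeasureTheory ProbabilityTheory Filter Topology
open scoped NNReal Matrix.Norms.Frobenius

noncomputable section

namespace SpikedModel

/-- A singular value decomposition `Y = ∑ₖ σₖ ûₖ v̂ₖᵀ`, `k < min p n`, of a real `p × n` matrix, with
the singular values in decreasing order. (It need not be unique.) -/
structure SVD {p n : ℕ} (Y : Matrix (Fin p) (Fin n) ℝ) where
  val : Fin (min p n) → ℝ
  left : Fin (min p n) → EuclideanSpace ℝ (Fin p)
  right : Fin (min p n) → EuclideanSpace ℝ (Fin n)
  nonneg : ∀ k, 0 ≤ val k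
  antitone : Antitone val
  orthonormal_left : Orthonormal ℝ left
  orthonormal_right : Orthonormal ℝ right
  eq_sum : Y = Matrix.of fun i j => ∑ k, val k * left k i * right k j

/-- The `k`-th singular value (counting from `0`), and `0` if `k ≥ min p n`. -/
def SVD.singularValue {p n : ℕ} {Y : Matrix (Fin p) (Fin n) ℝ} (S : SVD Y) (k : ℕ) : ℝ :=
  if h : k < min p n then S.val ⟨k, h⟩ else 0

/-- The singular value shrinkage estimator `∑_{k < r} qₖ ûₖ v̂ₖᵀ`, which keeps the top `r` singular
vectors of `Y` and replaces the singular values by `q`. (Terms with `k ≥ min p n`, for which there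
are no singular vectors, are left out.) -/
def SVD.shrink {p n : ℕ} {Y : Matrix (Fin p) (Fin n) ℝ} (S : SVD Y) {r : ℕ} (q : Fin r → ℝ) :
    Matrix (Fin p) (Fin n) ℝ :=
  Matrix.of fun i j => ∑ k : Fin r,
    if h : (k : ℕ) < min p n then q k * S.left ⟨k, h⟩ i * S.right ⟨k, h⟩ j else 0

/-- The asymptotic cosine `c` between a left singular vector of the signal with strength `t` and the
corresponding one of the observed matrix, at aspect ratio `γ`. -/
def leftCos (γ t : ℝ) : ℝ :=
  if γ ^ (1 / 4 : ℝ) < t then √((1 - γ / t ^ 4) / (1 + γ / t ^ 2)) else 0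

/-- The asymptotic cosine `c̃` between the right singular vectors. -/
def rightCos (γ t : ℝ) : ℝ :=
  if γ ^ (1 / 4 : ℝ) < t then √((1 - γ / t ^ 4) / (1 + 1 / t ^ 2)) else 0

/-- The asymptotic operator norm loss of one component, as a function of the singular value `q`:
the operator norm of the 2-by-2 block `diag(t, 0) - q (c, s)ᵀ (c̃, s̃)`, where `s = √(1 - c²)` and
`s̃ = √(1 - c̃²)`. -/
def blockLoss (γ t q : ℝ) : ℝ :=
  let c := leftCos γ t
  let c' := rightCos γ t
  let s := √(1 - c ^ 2)
  let s' := √(1 - c' ^ 2)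
  ‖Matrix.toEuclideanCLM (n := Fin 2) (𝕜 := ℝ)
    (!![t, 0; 0, 0] - q • !![c * c', c * s'; s * c', s * s'])‖

/-- `q` is an optimal singular value, for operator norm loss, for a component of strength `t` at
aspect ratio `γ`. -/
def IsOptimal (γ t q : ℝ) : Prop :=
  IsMinOn (blockLoss γ t) Set.univ q

/-- The estimate of the signal strength from an observed singular value `σ`, at aspect ratio `γ`;
it is set to `0` for a component that is not detectable. -/
def estimateStrength (γ σ : ℝ) : ℝ :=
  if 1 + √γ < σ then
    √((σ ^ 2 - 1 - γ + √((σ ^ 2 - 1 - γ) ^ 2 - 4 * γ)) / 2)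
  else 0

/-- The signal matrix `X`, whose `j`-th column is `Xⱼ / √n` with `Xⱼ = ∑ₖ tₖ zⱼₖ uₖ`. -/
def signal {p n r : ℕ} (t : Fin r → ℝ) (u : Fin r → EuclideanSpace ℝ (Fin p))
    (z : Fin n → Fin r → ℝ) : Matrix (Fin p) (Fin n) ℝ :=
  Matrix.of fun i j => (∑ k, (t k * z j k) • u k) i / √n

/-- The vector `Mⱼ ∈ ℝᵖ` such that the `j`-th column of `M` is `Mⱼ / √n`. -/
def col {p n : ℕ} (M : Matrix (Fin p) (Fin n) ℝ) (j : Fin n) : EuclideanSpace ℝ (Fin p) :=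
  WithLp.toLp 2 fun i => √n * M i j

/-- The matrix `[x₁, …, xₙ] / √n`. -/
def ofCols {p n : ℕ} (x : Fin n → EuclideanSpace ℝ (Fin p)) : Matrix (Fin p) (Fin n) ℝ :=
  Matrix.of fun i j => x j i / √n

/-- The linear map `A` gives the best linear predictor `A Y` of the random vector `X` from the
random vector `Y` (both of mean zero): it minimizes the mean squared error. -/
def IsBestLinearPredictor {Ω : Type*} [MeasurableSpace Ω] (P : Measure Ω) {p : ℕ}
    (X Y : Ω → EuclideanSpace ℝ (Fin p))
    (A : EuclideanSpace ℝ (Fin p) →L[ℝ] EuclideanSpace ℝ (Fin p)) : Prop :=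
  IsMinOn (fun B : EuclideanSpace ℝ (Fin p) →L[ℝ] EuclideanSpace ℝ (Fin p) =>
    ∫ ω, ‖X ω - B (Y ω)‖ ^ 2 ∂P) Set.univ A

end SpikedModel

end

/-!
The covariance of a column of the observed matrix is `Σ = 1 + ∑ₖ tₖ² uₖ uₖᵀ`, and all of the
randomness enters through the distance between `Σ` and the sample covariance `Y Yᵀ`.

* **Concentration.** For unit vectors `x`, `y`, the number `⟪x, Y Yᵀ y⟫` is an average of `n`
  independent products of sub-Gaussian variables, with parameters that do not depend on `n`, so it
  deviates from `⟪x, Σ y⟫` by `ε` with a probability of order `exp (-c n)` only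
  (`exists_exp_tail_bound`). The unit ball of `ℝᵖ` has a `1/2`-net of at most `5 ^ p` points
  (`exists_net_card_le`); since `p = o(n)`, the union bound over the net and the Borel-Cantelli lemma
  give `‖Y Yᵀ - Σ‖ → 0` almost surely (`ae_tendsto_sampleCov`), whatever the joint law for
  different `n` is.
* **Perturbation.** On this event everything is deterministic. The top eigenvalues `1 + tₖ²` of `Σ`
  are separated from each other and from the rest of the spectrum. Weyl's inequality therefore gives
  `σ̂ₖ² → 1 + tₖ²`, and the eigenvector equation gives `⟪ûₖ, uₖ⟫² → 1` (`eigen_perturbation`).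
* **Optimal singular values.** At aspect ratio `0` the left cosine is `1`, and the loss is the norm of
  a row vector, with the unique minimizer `tₖ² / √(1 + tₖ²)`. As the data of the minimization
  problem converge, the minimizers do so too (`tendsto_of_isOptimal`); this covers both choices of
  the singular values.
* **The best linear predictor.** The first order condition for least squares shows that it is
  `∑ₖ tₖ² / (1 + tₖ²) uₖ uₖᵀ` (`IsBestLinearPredictor.apply_eq`).

Finally, with `η = t² / (1 + t²)`, the squared Frobenius norm of `q û v̂ᵀ - η u uᵀ Y` is
`q² - 2 q η σ̂ ⟪û, u⟫² + η² ‖Yᵀ u‖²` (`SVD.norm_component_sq`), and the limits above make this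
tend to `q² - 2 q² + q² = 0`, as `η √(1 + t²)` is the limit of `q`.
-/

/-! ### Nets of the unit ball -/

/-- A linear map that is bounded by `C` on a `1/2`-net of the unit ball has norm at most `2 * C`. -/
theorem ContinuousLinearMap.opNorm_le_two_mul_of_net {E F : Type*} [NormedAddCommGroup E]
    [NormedSpace ℝ E] [NormedAddCommGroup F] [NormedSpace ℝ F] {N : Set E}
    (hN : ∀ x : E, ‖x‖ ≤ 1 → ∃ y ∈ N, ‖x - y‖ ≤ 1 / 2) (f : E →L[ℝ] F) {C : ℝ} (hC : 0 ≤ C)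
    (hf : ∀ y ∈ N, ‖f y‖ ≤ C) : ‖f‖ ≤ 2 * C := by
  have h : ‖f‖ ≤ C + ‖f‖ / 2 := by
    refine f.opNorm_le_of_unit_norm (by positivity) fun x hx => ?_
    obtain ⟨y, hy, hxy⟩ := hN x hx.le
    calc ‖f x‖ = ‖f y + f (x - y)‖ := by simp
      _ ≤ ‖f y‖ + ‖f (x - y)‖ := norm_add_le _ _
      _ ≤ C + ‖f‖ * (1 / 2) := by
        gcongr
        · exact hf y hy
        · exact (f.le_opNorm _).trans (by gcongr)
      _ = C + ‖f‖ / 2 := by ring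
  linarith

/-- A bilinear form that is bounded by `C` on a `1/2`-net of the unit ball has norm at most
`4 * C`. -/
theorem ContinuousLinearMap.opNorm_le_four_mul_of_net {E : Type*} [NormedAddCommGroup E]
    [NormedSpace ℝ E] {N : Set E} (hN : ∀ x : E, ‖x‖ ≤ 1 → ∃ y ∈ N, ‖x - y‖ ≤ 1 / 2)
    (B : E →L[ℝ] E →L[ℝ] ℝ) {C : ℝ} (hC : 0 ≤ C) (hB : ∀ x ∈ N, ∀ y ∈ N, |B x y| ≤ C) :
    ‖B‖ ≤ 4 * C := by
  have h := B.opNorm_le_two_mul_of_net hN (C := 2 * C) (by positivity) fun x hx =>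
    (B x).opNorm_le_two_mul_of_net hN hC fun y hy => hB x hx y hy
  linarith

/-- The unit ball of a `d`-dimensional space has a `1/2`-net of at most `5 ^ d` points, namely any
largest `1/2`-separated subset. -/
theorem exists_net_card_le (E : Type*) [NormedAddCommGroup E] [NormedSpace ℝ E]
    [FiniteDimensional ℝ E] :
    ∃ N : Finset E, N.card ≤ 5 ^ Module.finrank ℝ E ∧ (∀ x ∈ N, ‖x‖ ≤ 1) ∧
      ∀ x : E, ‖x‖ ≤ 1 → ∃ y ∈ N, ‖x - y‖ ≤ 1 / 2 := by
  classical
  let p : Finset E → Prop := fun N =>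
    (∀ x ∈ N, ‖x‖ ≤ 1) ∧ ∀ x ∈ N, ∀ y ∈ N, x ≠ y → 1 / 2 ≤ ‖x - y‖
  have hcard : ∀ N : Finset E, p N → N.card ≤ 5 ^ Module.finrank ℝ E := by
    intro N hN
    have hinj : Function.Injective fun x : E => (2 : ℝ) • x := smul_right_injective E two_ne_zero
    have h := Besicovitch.card_le_of_separated (N.image fun x => (2 : ℝ) • x) ?_ ?_
    · rwa [Finset.card_image_of_injective _ hinj] at h
    · intro c hc
      obtain ⟨x, hx, rfl⟩ := Finset.mem_image.1 hc
      have := hN.1 x hx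
      rw [norm_smul, Real.norm_ofNat]
      linarith
    · intro c hc d hd hcd
      obtain ⟨x, hx, rfl⟩ := Finset.mem_image.1 hc
      obtain ⟨y, hy, rfl⟩ := Finset.mem_image.1 hd
      have := hN.2 x hx y hy fun h => hcd (by rw [h])
      rw [← smul_sub, norm_smul, Real.norm_ofNat]
      linarith
  let s : Set ℕ := {m | ∃ N : Finset E, p N ∧ N.card = m}
  have hs : BddAbove s := ⟨5 ^ Module.finrank ℝ E, by rintro _ ⟨N, hN, rfl⟩; exact hcard N hN⟩
  have hne : s.Nonempty := ⟨0, ∅, by simp [p], rfl⟩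
  obtain ⟨N, hN, hNs⟩ := Nat.sSup_mem hne hs
  refine ⟨N, hcard N hN, hN.1, fun x hx => ?_⟩
  by_contra! hfar
  have hxN : x ∉ N := fun h => by
    have := hfar x h
    rw [sub_self, norm_zero] at this
    linarith
  have hins : p (insert x N) := by
    refine ⟨fun y hy => ?_, fun y hy w hw hyw => ?_⟩
    · rcases Finset.mem_insert.1 hy with rfl | hy
      · exact hx
      · exact hN.1 y hy
    · rcases Finset.mem_insert.1 hy with hy | hy <;> rcases Finset.mem_insert.1 hw with hw | hw
      · exact absurd (hy.trans hw.symm) hyw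
      · rw [hy]
        exact (hfar w hw).le
      · rw [hw, norm_sub_rev]
        exact (hfar y hy).le
      · exact hN.2 y hy w hw hyw
  have := le_csSup hs ⟨_, hins, rfl⟩
  rw [Finset.card_insert_of_notMem hxN, ← hNs] at this
  omega

/-! ### Minimizers over a line -/

/-- If `D n → D` and `M n → M ≠ 0`, and if `q ↦ ‖D - q • M‖` has no minimizer but `q₀`, then
minimizers of `q ↦ ‖D n - q • M n‖` converge to `q₀`: they stay bounded, and a limit point of theirs
minimizes the limit function. -/
theorem tendsto_of_isMinOn_norm_sub_smul {V : Type*} [NormedAddCommGroup V] [NormedSpace ℝ V]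
    {D M : ℕ → V} {D₀ M₀ : V} (hD : Tendsto D atTop (𝓝 D₀)) (hM : Tendsto M atTop (𝓝 M₀))
    (hM₀ : M₀ ≠ 0) {q : ℕ → ℝ} (hq : ∀ n (s : ℝ), ‖D n - q n • M n‖ ≤ ‖D n - s • M n‖) {q₀ : ℝ}
    (huniq : ∀ y : ℝ, (∀ s : ℝ, ‖D₀ - y • M₀‖ ≤ ‖D₀ - s • M₀‖) → y = q₀) :
    Tendsto q atTop (𝓝 q₀) := by
  have hM₀' : 0 < ‖M₀‖ := norm_pos_iff.2 hM₀
  have hlim : Tendsto (fun n => 2 * ‖D n‖ / ‖M n‖) atTop (𝓝 (2 * ‖D₀‖ / ‖M₀‖)) :=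
    (hD.norm.const_mul 2).div hM.norm hM₀'.ne'
  have hbdd : ∀ᶠ n in atTop, q n ∈ Set.Icc (-(2 * ‖D₀‖ / ‖M₀‖ + 1)) (2 * ‖D₀‖ / ‖M₀‖ + 1) := by
    filter_upwards [hlim.eventually (gt_mem_nhds (lt_add_one _)),
      hM.norm.eventually (lt_mem_nhds hM₀')] with n hn hMn
    rw [Set.mem_Icc, ← abs_le]
    refine le_trans ?_ hn.le
    rw [le_div_iff₀ hMn, ← Real.norm_eq_abs, ← norm_smul]
    have h0 := hq n 0
    rw [zero_smul, sub_zero] at h0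
    have := norm_sub_norm_le (q n • M n) (D n)
    rw [norm_sub_rev] at this
    linarith
  refine isCompact_Icc.tendsto_nhds_of_unique_mapClusterPt hbdd fun y _ hy => huniq y fun s => ?_
  obtain ⟨φ, hφ, hqφ⟩ := hy.tendsto_subseq
  have hDφ := hD.comp hφ.tendsto_atTop
  have hMφ := hM.comp hφ.tendsto_atTop
  exact le_of_tendsto_of_tendsto (hDφ.sub (hqφ.smul hMφ)).norm (hDφ.sub (hMφ.const_smul s)).norm
    (Eventually.of_forall fun n => hq (φ n) s)

namespace SpikedModel

/-! ### Optimal singular values -/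

theorem norm_toEuclideanCLM_row (a b : ℝ) :
    ‖Matrix.toEuclideanCLM (n := Fin 2) (𝕜 := ℝ) !![a, b; 0, 0]‖ = √(a ^ 2 + b ^ 2) := by
  have key : ∀ v : EuclideanSpace ℝ (Fin 2),
      ‖Matrix.toEuclideanCLM (n := Fin 2) (𝕜 := ℝ) !![a, b; 0, 0] v‖ = |a * v 0 + b * v 1| := by
    intro v
    rw [EuclideanSpace.norm_eq, ← Real.sqrt_sq_eq_abs]
    simp [Fin.sum_univ_two, Matrix.ofLp_toEuclideanCLM, Matrix.vecHead, Matrix.vecTail]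
  apply le_antisymm
  · refine ContinuousLinearMap.opNorm_le_bound _ (by positivity) fun v => ?_
    rw [key, EuclideanSpace.norm_eq, ← Real.sqrt_mul (by positivity), Fin.sum_univ_two]
    apply Real.abs_le_sqrt
    simp only [Real.norm_eq_abs, sq_abs]
    nlinarith [sq_nonneg (a * v 1 - b * v 0)]
  · rcases eq_or_lt_of_le (Real.sqrt_nonneg (a ^ 2 + b ^ 2)) with h | h
    · rw [← h]
      positivity
    · have := ContinuousLinearMap.le_opNorm
        (Matrix.toEuclideanCLM (n := Fin 2) (𝕜 := ℝ) !![a, b; 0, 0]) !₂[a, b]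
      rw [key, EuclideanSpace.norm_eq, Fin.sum_univ_two] at this
      simp only [Real.norm_eq_abs, sq_abs, Matrix.cons_val_zero,
        Matrix.cons_val_one, ← pow_two] at this
      rw [abs_of_nonneg (by positivity)] at this
      refine le_of_mul_le_mul_right ?_ h
      rwa [Real.mul_self_sqrt (by positivity)]

theorem tendsto_toEuclideanCLM {a b c d : ℕ → ℝ} {a₀ b₀ c₀ d₀ : ℝ}
    (ha : Tendsto a atTop (𝓝 a₀)) (hb : Tendsto b atTop (𝓝 b₀)) (hc : Tendsto c atTop (𝓝 c₀))
    (hd : Tendsto d atTop (𝓝 d₀)) :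
    Tendsto (fun n => Matrix.toEuclideanCLM (n := Fin 2) (𝕜 := ℝ) !![a n, b n; c n, d n]) atTop
      (𝓝 (Matrix.toEuclideanCLM (n := Fin 2) (𝕜 := ℝ) !![a₀, b₀; c₀, d₀])) := by
  have h : ∀ w x y z : ℝ, Matrix.toEuclideanCLM (n := Fin 2) (𝕜 := ℝ) !![w, x; y, z] =
      w • Matrix.toEuclideanCLM (n := Fin 2) (𝕜 := ℝ) !![1, 0; 0, 0] +
      x • Matrix.toEuclideanCLM (n := Fin 2) (𝕜 := ℝ) !![0, 1; 0, 0] +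
      y • Matrix.toEuclideanCLM (n := Fin 2) (𝕜 := ℝ) !![0, 0; 1, 0] +
      z • Matrix.toEuclideanCLM (n := Fin 2) (𝕜 := ℝ) !![0, 0; 0, 1] := by
    intro w x y z
    simp only [← map_smul, ← map_add]
    congr 1
    ext i j
    fin_cases i <;> fin_cases j <;> simp
  rw [funext fun n => h (a n) (b n) (c n) (d n), h a₀ b₀ c₀ d₀]
  exact ((ha.smul_const _).add (hb.smul_const _)).add (hc.smul_const _) |>.add (hd.smul_const _)

theorem tendsto_rpow_quarter_lt {γ τ : ℕ → ℝ} {t : ℝ} (ht : 0 < t)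
    (hγ : Tendsto γ atTop (𝓝 0)) (hτ : Tendsto τ atTop (𝓝 t)) :
    ∀ᶠ n in atTop, γ n ^ (1 / 4 : ℝ) < τ n := by
  have h : Tendsto (fun n => γ n ^ (1 / 4 : ℝ)) atTop (𝓝 0) := by
    have := hγ.rpow_const (p := (1 / 4 : ℝ)) (Or.inr (by norm_num))
    rwa [Real.zero_rpow (by norm_num)] at this
  exact h.eventually_lt hτ ht

theorem tendsto_leftCos {γ τ : ℕ → ℝ} {t : ℝ} (ht : 0 < t)
    (hγ : Tendsto γ atTop (𝓝 0)) (hτ : Tendsto τ atTop (𝓝 t)) :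
    Tendsto (fun n => leftCos (γ n) (τ n)) atTop (𝓝 1) := by
  have h : Tendsto (fun n => √((1 - γ n / τ n ^ 4) / (1 + γ n / τ n ^ 2))) atTop
      (𝓝 √((1 - 0 / t ^ 4) / (1 + 0 / t ^ 2))) :=
    (((hγ.div (hτ.pow 4) (by positivity)).const_sub 1).div
      ((hγ.div (hτ.pow 2) (by positivity)).const_add 1) (by simp)).sqrt
  rw [show √((1 - 0 / t ^ 4) / (1 + 0 / t ^ 2)) = 1 by simp] at h
  refine h.congr' ?_
  filter_upwards [tendsto_rpow_quarter_lt ht hγ hτ] with n hn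
  rw [leftCos, if_pos hn]

theorem tendsto_rightCos {γ τ : ℕ → ℝ} {t : ℝ} (ht : 0 < t)
    (hγ : Tendsto γ atTop (𝓝 0)) (hτ : Tendsto τ atTop (𝓝 t)) :
    Tendsto (fun n => rightCos (γ n) (τ n)) atTop (𝓝 (t / √(1 + t ^ 2))) := by
  have h : Tendsto (fun n => √((1 - γ n / τ n ^ 4) / (1 + 1 / τ n ^ 2))) atTop
      (𝓝 √((1 - 0 / t ^ 4) / (1 + 1 / t ^ 2))) :=
    (((hγ.div (hτ.pow 4) (by positivity)).const_sub 1).div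
      ((tendsto_const_nhds.div (hτ.pow 2) (by positivity)).const_add 1) (by positivity)).sqrt
  have h' : √((1 - 0 / t ^ 4) / (1 + 1 / t ^ 2)) = t / √(1 + t ^ 2) := by
    rw [show (1 - 0 / t ^ 4) / (1 + 1 / t ^ 2) = t ^ 2 / (1 + t ^ 2) by field_simp; ring,
      Real.sqrt_div (by positivity), Real.sqrt_sq ht.le]
  rw [h'] at h
  refine h.congr' ?_
  filter_upwards [tendsto_rpow_quarter_lt ht hγ hτ] with n hn
  rw [rightCos, if_pos hn]

/-- As the aspect ratio tends to `0`, the optimal singular values of a component whose strength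
tends to `t` tend to `t² / √(1 + t²)`. The limit of the loss is the norm of a single row vector,
`q ↦ √((t - q c̃)² + q² s̃²)`, which has this number as its only minimizer. -/
theorem tendsto_of_isOptimal {γ τ : ℕ → ℝ} {t : ℝ} (ht : 0 < t)
    (hγ : Tendsto γ atTop (𝓝 0)) (hτ : Tendsto τ atTop (𝓝 t)) {q : ℕ → ℝ}
    (hq : ∀ n, IsOptimal (γ n) (τ n) (q n)) :
    Tendsto q atTop (𝓝 (t ^ 2 / √(1 + t ^ 2))) := by
  have hc := tendsto_leftCos ht hγ hτ
  have hc' := tendsto_rightCos ht hγ hτ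
  have hs : Tendsto (fun n => √(1 - leftCos (γ n) (τ n) ^ 2)) atTop (𝓝 0) := by
    simpa using ((hc.pow 2).const_sub 1).sqrt
  set κ := t / √(1 + t ^ 2) with hκ
  have hκ2 : κ ^ 2 = t ^ 2 / (1 + t ^ 2) := by
    rw [hκ, div_pow, Real.sq_sqrt (by positivity)]
  have hκpos : 0 < κ := by positivity
  have hκ1 : κ ^ 2 ≤ 1 := by
    rw [hκ2, div_le_one (by positivity)]
    linarith
  have hs' := ((hc'.pow 2).const_sub 1).sqrt
  have hs2 : √(1 - κ ^ 2) ^ 2 = 1 - κ ^ 2 := Real.sq_sqrt (by linarith)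
  have hq₀ : t ^ 2 / √(1 + t ^ 2) = t * κ := by rw [hκ]; ring
  rw [hq₀]
  refine tendsto_of_isMinOn_norm_sub_smul
    (tendsto_toEuclideanCLM hτ (tendsto_const_nhds (x := 0)) (tendsto_const_nhds (x := 0))
      (tendsto_const_nhds (x := 0)))
    (tendsto_toEuclideanCLM (hc.mul hc') (hc.mul hs') (hs.mul hc') (hs.mul hs')) ?_ ?_ ?_
  · rw [zero_mul, zero_mul, one_mul, one_mul, ← norm_pos_iff, norm_toEuclideanCLM_row]
    positivity
  · intro n s
    have := hq n (Set.mem_univ s)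
    simp only [Set.mem_ofPred_eq, blockLoss, map_sub, map_smul] at this
    exact this
  · intro y hy
    have := hy (t * κ)
    simp only [zero_mul, one_mul, ← map_smul, ← map_sub] at this
    have e : ∀ x : ℝ, !![t, 0; 0, 0] - x • !![κ, √(1 - κ ^ 2); 0, 0] =
        !![t - x * κ, -(x * √(1 - κ ^ 2)); 0, 0] := by
      intro x
      ext i j
      fin_cases i <;> fin_cases j <;> simp
    rw [e, e, norm_toEuclideanCLM_row, norm_toEuclideanCLM_row,
      Real.sqrt_le_sqrt_iff (by positivity)] at this
    simp only [neg_sq, mul_pow, hs2] at this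
    have h0 : (y - t * κ) ^ 2 ≤ 0 := by nlinarith
    nlinarith [pow_eq_zero_iff (two_ne_zero) |>.1 (le_antisymm h0 (sq_nonneg _))]

/-- The estimate of the strength is consistent as the aspect ratio tends to `0`, since then
`σ² → 1 + t²`. -/
theorem tendsto_estimateStrength {γ σ : ℕ → ℝ} {t : ℝ} (ht : 0 < t)
    (hγ : Tendsto γ atTop (𝓝 0)) (hσ : Tendsto σ atTop (𝓝 √(1 + t ^ 2))) :
    Tendsto (fun n => estimateStrength (γ n) (σ n)) atTop (𝓝 t) := by
  have h1 : Tendsto (fun n => σ n ^ 2 - 1 - γ n) atTop (𝓝 (t ^ 2)) := by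
    have := ((hσ.pow 2).sub_const 1).sub hγ
    rwa [Real.sq_sqrt (by positivity), show 1 + t ^ 2 - 1 - 0 = t ^ 2 by ring] at this
  have h2 := ((h1.add ((h1.pow 2).sub (hγ.const_mul 4)).sqrt).div_const 2).sqrt
  have h3 : √((t ^ 2 + √((t ^ 2) ^ 2 - 4 * 0)) / 2) = t := by
    rw [mul_zero, sub_zero, Real.sqrt_sq (by positivity), add_self_div_two, Real.sqrt_sq ht.le]
  rw [h3] at h2
  refine h2.congr' ?_
  have h4 : Tendsto (fun n => 1 + √(γ n)) atTop (𝓝 1) := by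
    simpa using hγ.sqrt.const_add 1
  have h5 : (1 : ℝ) < √(1 + t ^ 2) := by
    rw [Real.lt_sqrt (by norm_num)]
    nlinarith
  filter_upwards [h4.eventually_lt hσ h5] with n hn
  rw [estimateStrength, if_pos hn]

end SpikedModel

/-! ### Perturbation of the leading eigenvectors -/

section Perturbation

variable {E : Type*} [NormedAddCommGroup E] [InnerProductSpace ℝ E]

/-- Among the combinations of `k + 1` vectors there is a nontrivial one that is orthogonal to `k`
given vectors. -/
theorem exists_sum_smul_inner_eq_zero {k : ℕ} (e : Fin (k + 1) → E) (f : Fin k → E) :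
    ∃ a : Fin (k + 1) → ℝ, 0 < ∑ i, a i ^ 2 ∧ ∀ i, inner ℝ (f i) (∑ j, a j • e j) = 0 := by
  let L : (Fin (k + 1) → ℝ) →ₗ[ℝ] Fin k → ℝ := Matrix.mulVecLin (.of fun i j => inner ℝ (f i) (e j))
  have hL : LinearMap.ker L ≠ ⊥ := L.ker_ne_bot_of_finrank_lt (by simp)
  obtain ⟨a, ha, ha0⟩ := Submodule.exists_mem_ne_zero_of_ne_bot hL
  refine ⟨a, ?_, fun i => ?_⟩
  · obtain ⟨i, hi⟩ := Function.ne_iff.1 ha0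
    exact Finset.sum_pos' (fun i _ => sq_nonneg _) ⟨i, Finset.mem_univ _, sq_pos_of_ne_zero hi⟩
  · have := congrFun (LinearMap.mem_ker.1 ha) i
    simp only [L, Matrix.mulVecLin_apply, Matrix.mulVec, dotProduct, Matrix.of_apply,
      Pi.zero_apply] at this
    simpa [inner_sum, real_inner_smul_right, mul_comm] using this

theorem Orthonormal.norm_sum_smul_sq {ι : Type*} [Fintype ι] {e : ι → E} (he : Orthonormal ℝ e)
    (a : ι → ℝ) : ‖∑ i, a i • e i‖ ^ 2 = ∑ i, a i ^ 2 := by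
  rw [← real_inner_self_eq_norm_sq, he.inner_sum]
  simp [pow_two]

/-- Weyl's inequality: if `B₁` is at least `α` on a space of dimension `k + 1` and `B₂` is at most
`β` on a space of codimension `k`, then `α` exceeds `β` by at most `‖B₁ - B₂‖`. -/
theorem le_add_of_quadratic_bounds {k : ℕ} {e : Fin (k + 1) → E} (he : Orthonormal ℝ e)
    (f : Fin k → E) {B₁ B₂ : E →L[ℝ] E →L[ℝ] ℝ} {α β δ : ℝ} (hδ : ‖B₁ - B₂‖ ≤ δ)
    (h₁ : ∀ a : Fin (k + 1) → ℝ,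
      α * ∑ i, a i ^ 2 ≤ B₁ (∑ i, a i • e i) (∑ i, a i • e i))
    (h₂ : ∀ x, (∀ i, inner ℝ (f i) x = 0) → B₂ x x ≤ β * ‖x‖ ^ 2) : α ≤ β + δ := by
  obtain ⟨a, ha, hf⟩ := exists_sum_smul_inner_eq_zero e f
  have h1 := h₁ a
  have h2 := h₂ _ hf
  have hnorm := he.norm_sum_smul_sq a
  set x := ∑ i, a i • e i
  have h3 : (B₁ - B₂) x x ≤ δ * ‖x‖ ^ 2 := by
    refine (le_abs_self _).trans ?_
    refine ((B₁ - B₂).le_opNorm₂ x x).trans ?_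
    rw [mul_assoc, ← pow_two]
    gcongr
  simp only [sub_apply] at h3
  rw [hnorm] at h2 h3
  exact le_of_mul_le_mul_right (by linarith) ha

theorem mul_sum_sq_le_sum_inner_sq {m k : ℕ} (hk : k < m) {e : Fin m → E} (he : Orthonormal ℝ e)
    {l : Fin m → ℝ} (hl : ∀ i, 0 ≤ l i) (hanti : Antitone l) (a : Fin (k + 1) → ℝ) :
    l ⟨k, hk⟩ * ∑ i, a i ^ 2 ≤
      ∑ i, l i * inner ℝ (e i) (∑ j, a j • e (Fin.castLE hk j)) ^ 2 := by
  set x := ∑ j, a j • e (Fin.castLE hk j)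
  have hx : ∀ j, inner ℝ (e (Fin.castLE hk j)) x = a j := fun j =>
    (he.comp _ (Fin.castLE_injective hk)).inner_right_fintype a j
  calc l ⟨k, hk⟩ * ∑ i, a i ^ 2
      ≤ ∑ j : Fin (k + 1), l (Fin.castLE hk j) * inner ℝ (e (Fin.castLE hk j)) x ^ 2 := by
        rw [Finset.mul_sum]
        refine Finset.sum_le_sum fun j _ => ?_
        rw [hx]
        gcongr
        exact hanti (Fin.le_def.2 (Nat.lt_succ_iff.1 j.2))
    _ = ∑ i ∈ Finset.univ.map (Fin.castLEEmb hk), l i * inner ℝ (e i) x ^ 2 := by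
        rw [Finset.sum_map]
        rfl
    _ ≤ ∑ i, l i * inner ℝ (e i) x ^ 2 :=
        Finset.sum_le_sum_of_subset_of_nonneg (Finset.subset_univ _) fun i _ _ =>
          mul_nonneg (hl i) (sq_nonneg _)

theorem sum_inner_sq_le_norm_sq {m : ℕ} {e : Fin m → E} (he : Orthonormal ℝ e) (x : E) :
    ∑ i, inner ℝ (e i) x ^ 2 ≤ ‖x‖ ^ 2 := by
  simpa using he.sum_inner_products_le (s := Finset.univ) x

theorem sum_inner_sq_le_mul_norm_sq {m k : ℕ} (hk : k < m) {e : Fin m → E} (he : Orthonormal ℝ e)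
    {l : Fin m → ℝ} (hl : ∀ i, 0 ≤ l i) (hanti : Antitone l) {x : E}
    (hx : ∀ i : Fin k, inner ℝ (e (Fin.castLE hk.le i)) x = 0) :
    ∑ i, l i * inner ℝ (e i) x ^ 2 ≤ l ⟨k, hk⟩ * ‖x‖ ^ 2 := by
  calc ∑ i, l i * inner ℝ (e i) x ^ 2 ≤ ∑ i, l ⟨k, hk⟩ * inner ℝ (e i) x ^ 2 := by
        refine Finset.sum_le_sum fun i _ => ?_
        rcases lt_or_ge (i : ℕ) k with h | h
        · rw [show inner ℝ (e i) x = 0 from hx ⟨i, h⟩]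
          simp
        · gcongr
          exact hanti (Fin.le_def.2 h)
    _ = l ⟨k, hk⟩ * ∑ i, inner ℝ (e i) x ^ 2 := by rw [Finset.mul_sum]
    _ ≤ l ⟨k, hk⟩ * ‖x‖ ^ 2 := by
        gcongr
        · exact hl _
        · exact sum_inner_sq_le_norm_sq he x

end Perturbation

namespace SpikedModel

/-- The covariance of the columns of the observed matrix, as a bilinear form: the identity plus
`∑ₖ tₖ² uₖ uₖᵀ`. -/
noncomputable def populationCov {E : Type*} [NormedAddCommGroup E] [InnerProductSpace ℝ E] {r : ℕ}
    (t : Fin r → ℝ) (u : Fin r → E) : E →L[ℝ] E →L[ℝ] ℝ :=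
  let I : E →L[ℝ] E →L[ℝ] ℝ := innerSL ℝ
  I + ∑ k, t k ^ 2 • (innerSL ℝ (u k)).smulRight (innerSL ℝ (u k))

/-- The sample covariance `n⁻¹ ∑ⱼ Yⱼ Yⱼᵀ` of the columns `Yⱼ`, as a bilinear form. -/
noncomputable def sampleCov {p n : ℕ} (Y : Matrix (Fin p) (Fin n) ℝ) :
    EuclideanSpace ℝ (Fin p) →L[ℝ] EuclideanSpace ℝ (Fin p) →L[ℝ] ℝ :=
  (n : ℝ)⁻¹ • ∑ j, (innerSL ℝ (col Y j)).smulRight (innerSL ℝ (col Y j))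

section Population

variable {E : Type*} [NormedAddCommGroup E] [InnerProductSpace ℝ E] {r : ℕ} {t : Fin r → ℝ}
  {u : Fin r → E}

theorem populationCov_apply (x y : E) : populationCov t u x y =
    inner ℝ x y + ∑ k, t k ^ 2 * inner ℝ (u k) x * inner ℝ (u k) y := by
  simp [populationCov, sum_apply, mul_assoc, mul_left_comm]
  rfl

theorem populationCov_self (x : E) : populationCov t u x x =
    ‖x‖ ^ 2 + ∑ k, t k ^ 2 * inner ℝ (u k) x ^ 2 := by
  rw [populationCov_apply, real_inner_self_eq_norm_sq]
  simp only [pow_two, mul_assoc]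

theorem populationCov_component (hu : Orthonormal ℝ u) (k : Fin r) (y : E) :
    populationCov t u (u k) y = (1 + t k ^ 2) * inner ℝ (u k) y := by
  rw [populationCov_apply]
  simp only [orthonormal_iff_ite.1 hu]
  simp
  ring

/-- The quantitative perturbation bound: if a form `B` with orthonormal eigenvectors `v` and
decreasing eigenvalues `l` is `δ`-close to the population covariance, and `δ` is smaller than half
the relevant gaps, then the `k`-th eigenvalue is close to `1 + tₖ²` and the `k`-th eigenvector is
nearly parallel to `uₖ`. -/
theorem eigen_perturbation (hu : Orthonormal ℝ u) (ht : ∀ k, 0 < t k) (hanti : StrictAnti t)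
    {m : ℕ} {v : Fin m → E} (hv : Orthonormal ℝ v) {l : Fin m → ℝ} (hl : ∀ i, 0 ≤ l i)
    (hlanti : Antitone l) {B : E →L[ℝ] E →L[ℝ] ℝ}
    (hB : ∀ x y, B x y = ∑ i, l i * inner ℝ (v i) x * inner ℝ (v i) y) {δ : ℝ}
    (hδ : ‖B - populationCov t u‖ ≤ δ) (k : Fin r) (hk : (k : ℕ) < m) :
    |l ⟨k, hk⟩ - (1 + t k ^ 2)| ≤ δ ∧
    ∀ g > 0, δ ≤ g → (∀ j ≠ k, 2 * g ≤ |t j ^ 2 - t k ^ 2|) → 2 * g ≤ t k ^ 2 →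
      1 - inner ℝ (u k) (v ⟨k, hk⟩) ^ 2 ≤ (r + 1) * (δ / g) ^ 2 := by
  have hBself : ∀ x, B x x = ∑ i, l i * inner ℝ (v i) x ^ 2 := fun x => by
    rw [hB]
    simp only [pow_two, mul_assoc]
  have ht2 : Antitone fun k => t k ^ 2 := fun i j hij =>
    pow_le_pow_left₀ (ht j).le (hanti.antitone hij) 2
  -- Weyl's inequality, with test spaces spanned by the top `k + 1` vectors of either family
  have heig : |l ⟨k, hk⟩ - (1 + t k ^ 2)| ≤ δ := by
    rw [abs_sub_le_iff]
    constructor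
    · have := le_add_of_quadratic_bounds (hv.comp _ (Fin.castLE_injective hk))
        (fun i => u (Fin.castLE k.2.le i)) (α := l ⟨k, hk⟩) (β := 1 + t k ^ 2) hδ ?_ ?_
      · linarith
      · intro a
        rw [hBself]
        exact mul_sum_sq_le_sum_inner_sq hk hv hl hlanti a
      · intro x hx
        have := sum_inner_sq_le_mul_norm_sq k.2 hu (fun i => sq_nonneg (t i)) ht2 hx
        rw [populationCov_self]
        linarith
    · have := le_add_of_quadratic_bounds (hu.comp _ (Fin.castLE_injective k.2))
        (fun i => v (Fin.castLE hk.le i)) (α := 1 + t k ^ 2) (β := l ⟨k, hk⟩)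
        (B₁ := populationCov t u) (B₂ := B) ((norm_sub_rev (populationCov t u) B).trans_le hδ) ?_ ?_
      · linarith
      · intro a
        have h := mul_sum_sq_le_sum_inner_sq k.2 hu (fun i => sq_nonneg (t i)) ht2 a
        have h' := (hu.comp _ (Fin.castLE_injective k.2)).norm_sum_smul_sq a
        rw [populationCov_self]
        simp only [Function.comp_apply] at h' ⊢
        linarith
      · intro x hx
        rw [hBself]
        exact sum_inner_sq_le_mul_norm_sq hk hv hl hlanti hx
  refine ⟨heig, fun g hg hδg hgap hgap' => ?_⟩
  set w := v ⟨k, hk⟩ with hw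
  have hwnorm : ‖w‖ = 1 := hv.1 _
  -- `w` is an eigenvector of `B`
  have hBw : ∀ x, B x w = l ⟨k, hk⟩ * inner ℝ x w := by
    intro x
    rw [hB]
    simp only [hw, orthonormal_iff_ite.1 hv]
    simp [real_inner_comm]
  have hdiff : ∀ x, |B x w - populationCov t u x w| ≤ δ * ‖x‖ := by
    intro x
    have := (B - populationCov t u).le_opNorm₂ x w
    rw [hwnorm, mul_one] at this
    exact this.trans (by gcongr)
  have hcoef : ∀ j ≠ k, inner ℝ (u j) w ^ 2 ≤ (δ / g) ^ 2 := by
    intro j hj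
    have h1 := hdiff (u j)
    rw [hBw, populationCov_component hu, ← sub_mul, abs_mul, hu.1, mul_one] at h1
    have h2 : g ≤ |l ⟨k, hk⟩ - (1 + t j ^ 2)| := by
      have h3 := hgap j hj
      have h4 := abs_sub_le (t j ^ 2) (l ⟨k, hk⟩ - 1) (t k ^ 2)
      rw [abs_sub_comm (t j ^ 2) (l ⟨k, hk⟩ - 1)] at h4
      rw [show l ⟨k, hk⟩ - 1 - t k ^ 2 = l ⟨k, hk⟩ - (1 + t k ^ 2) by ring,
        show l ⟨k, hk⟩ - 1 - t j ^ 2 = l ⟨k, hk⟩ - (1 + t j ^ 2) by ring] at h4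
      linarith
    rw [← sq_abs]
    gcongr
    rw [le_div_iff₀ hg]
    calc |inner ℝ (u j) w| * g ≤ |inner ℝ (u j) w| * |l ⟨k, hk⟩ - (1 + t j ^ 2)| := by gcongr
      _ ≤ δ := by rwa [mul_comm]
  -- the part of `w` orthogonal to all components
  set y := w - ∑ j, inner ℝ (u j) w • u j with hy
  have huy : ∀ j, inner ℝ (u j) y = 0 := fun j => by
    rw [hy, inner_sub_right, hu.inner_right_fintype, sub_self]
  have hwy : w = y + ∑ j, inner ℝ (u j) w • u j := by rw [hy]; abel
  have hyw : inner ℝ y w = ‖y‖ ^ 2 := by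
    conv_lhs => rw [hwy]
    rw [inner_add_right, real_inner_self_eq_norm_sq, inner_sum]
    simp [real_inner_smul_right, real_inner_comm (u _) y, huy]
  have hpyth : ‖y‖ ^ 2 + ∑ j, inner ℝ (u j) w ^ 2 = 1 := by
    have h1 : inner ℝ w w = (1 : ℝ) := by rw [real_inner_self_eq_norm_sq, hwnorm, one_pow]
    have h2 : inner ℝ w w = inner ℝ (y + ∑ j, inner ℝ (u j) w • u j) w := by rw [← hwy]
    rw [← h1, h2, inner_add_left, hyw, sum_inner]
    simp [real_inner_smul_left, pow_two]
  have hynorm : ‖y‖ ^ 2 ≤ (δ / g) ^ 2 := by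
    gcongr
    rcases (norm_nonneg y).eq_or_lt with h0 | h0
    · rw [← h0]
      have : 0 ≤ δ := (norm_nonneg (B - populationCov t u)).trans hδ
      positivity
    have h1 := hdiff y
    rw [hBw, populationCov_apply] at h1
    simp only [huy, mul_zero, zero_mul, Finset.sum_const_zero, add_zero] at h1
    rw [hyw] at h1
    have h2 : g ≤ l ⟨k, hk⟩ - 1 := by
      have := (abs_sub_le_iff.1 heig).2
      linarith
    rw [le_div_iff₀ hg]
    refine le_of_mul_le_mul_right ?_ h0
    calc ‖y‖ * g * ‖y‖ ≤ ‖y‖ * (l ⟨k, hk⟩ - 1) * ‖y‖ := by gcongr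
      _ = l ⟨k, hk⟩ * ‖y‖ ^ 2 - ‖y‖ ^ 2 := by ring
      _ ≤ δ * ‖y‖ := (le_abs_self _).trans h1
  have hsum : ∑ j, inner ℝ (u j) w ^ 2 =
      inner ℝ (u k) w ^ 2 + ∑ j ∈ Finset.univ.erase k, inner ℝ (u j) w ^ 2 :=
    (Finset.add_sum_erase _ _ (Finset.mem_univ k)).symm
  have hrest : ∑ j ∈ Finset.univ.erase k, inner ℝ (u j) w ^ 2 ≤ r * (δ / g) ^ 2 := by
    calc _ ≤ ∑ j ∈ Finset.univ.erase k, (δ / g) ^ 2 :=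
          Finset.sum_le_sum fun j hj => hcoef j (Finset.ne_of_mem_erase hj)
      _ ≤ ∑ j : Fin r, (δ / g) ^ 2 :=
          Finset.sum_le_sum_of_subset_of_nonneg (Finset.subset_univ _) fun _ _ _ => sq_nonneg _
      _ = r * (δ / g) ^ 2 := by simp
  linarith

/-- The gaps between the squared strengths, and between them and zero, are bounded below. -/
theorem exists_gap (ht : ∀ k, 0 < t k) (hanti : StrictAnti t) (k : Fin r) :
    ∃ g > 0, (∀ j ≠ k, 2 * g ≤ |t j ^ 2 - t k ^ 2|) ∧ 2 * g ≤ t k ^ 2 := by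
  have h0 : Tendsto (fun g : ℝ => 2 * g) (𝓝[>] 0) (𝓝 0) := by
    have : Tendsto (fun g : ℝ => 2 * g) (𝓝 0) (𝓝 (2 * 0)) := tendsto_id.const_mul 2
    rw [mul_zero] at this
    exact this.mono_left nhdsWithin_le_nhds
  have h1 : ∀ j, ∀ᶠ g in 𝓝[>] (0 : ℝ), j ≠ k → 2 * g ≤ |t j ^ 2 - t k ^ 2| := by
    intro j
    by_cases hj : j = k
    · exact Eventually.of_forall fun g h => absurd hj h
    have : 0 < |t j ^ 2 - t k ^ 2| := by
      rw [abs_pos, sub_ne_zero]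
      exact fun h => hj (hanti.injective ((pow_left_inj₀ (ht j).le (ht k).le two_ne_zero).1 h))
    filter_upwards [h0.eventually (ge_mem_nhds this)] with g hg _ using hg
  have h2 : ∀ᶠ g in 𝓝[>] (0 : ℝ), 2 * g ≤ t k ^ 2 :=
    h0.eventually (ge_mem_nhds (pow_pos (ht k) 2))
  obtain ⟨g, ⟨hg1, hg2⟩, hg3⟩ :=
    (((eventually_all.2 h1).and h2).and self_mem_nhdsWithin).exists
  exact ⟨g, hg3, hg1, hg2⟩

end Population

end SpikedModel

namespace SpikedModel

/-! ### Sample covariance and singular value decomposition -/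

theorem inner_eq_sum {p : ℕ} (x y : EuclideanSpace ℝ (Fin p)) : inner ℝ x y = ∑ i, x i * y i := by
  simp [PiLp.inner_apply, mul_comm]

theorem sampleCov_apply {p n : ℕ} (Y : Matrix (Fin p) (Fin n) ℝ) (x y : EuclideanSpace ℝ (Fin p)) :
    sampleCov Y x y = (n : ℝ)⁻¹ * ∑ j, inner ℝ x (col Y j) * inner ℝ y (col Y j) := by
  simp [sampleCov, sum_apply, real_inner_comm]

theorem inner_col {p n : ℕ} (Y : Matrix (Fin p) (Fin n) ℝ) (x : EuclideanSpace ℝ (Fin p))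
    (j : Fin n) : inner ℝ x (col Y j) = √n * ∑ i, Y i j * x i := by
  rw [inner_eq_sum, Finset.mul_sum]
  refine Finset.sum_congr rfl fun i _ => ?_
  simp [col]
  ring

theorem sampleCov_eq_sum {p n : ℕ} (Y : Matrix (Fin p) (Fin n) ℝ)
    (x y : EuclideanSpace ℝ (Fin p)) :
    sampleCov Y x y = ∑ j, (∑ i, Y i j * x i) * ∑ i, Y i j * y i := by
  rw [sampleCov_apply, Finset.mul_sum]
  refine Finset.sum_congr rfl fun j _ => ?_
  have hn : (n : ℝ) ≠ 0 := Nat.cast_ne_zero.2 (Nat.ne_of_gt j.pos)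
  rw [inner_col, inner_col]
  have := Real.mul_self_sqrt (Nat.cast_nonneg (α := ℝ) n)
  calc (n : ℝ)⁻¹ * (√n * (∑ i, Y i j * x i) * (√n * ∑ i, Y i j * y i))
      = (n : ℝ)⁻¹ * (√n * √n) * ((∑ i, Y i j * x i) * ∑ i, Y i j * y i) := by ring
    _ = _ := by rw [this, inv_mul_cancel₀ hn, one_mul]

section SVD

variable {p n : ℕ} {Y : Matrix (Fin p) (Fin n) ℝ} (S : SVD Y)

theorem SVD.transpose_apply (x : EuclideanSpace ℝ (Fin p)) (j : Fin n) :
    ∑ i, Y i j * x i = ∑ k, S.val k * inner ℝ (S.left k) x * S.right k j := by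
  have h : ∀ i, Y i j = ∑ k, S.val k * S.left k i * S.right k j := fun i => by
    conv_lhs => rw [S.eq_sum]
    rfl
  simp only [h, inner_eq_sum, Finset.sum_mul, Finset.mul_sum]
  rw [Finset.sum_comm]
  refine Finset.sum_congr rfl fun k _ => Finset.sum_congr rfl fun i _ => by ring

/-- `Yᵀ x = ∑ₖ σₖ ⟪ûₖ, x⟫ v̂ₖ`. -/
theorem SVD.toLp_transpose_apply (x : EuclideanSpace ℝ (Fin p)) :
    (WithLp.toLp 2 fun j => ∑ i, Y i j * x i : EuclideanSpace ℝ (Fin n)) =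
      ∑ k, (S.val k * inner ℝ (S.left k) x) • S.right k := by
  ext j
  simp [S.transpose_apply]

theorem SVD.sampleCov_apply (x y : EuclideanSpace ℝ (Fin p)) :
    sampleCov Y x y = ∑ k, S.val k ^ 2 * inner ℝ (S.left k) x * inner ℝ (S.left k) y := by
  have h : sampleCov Y x y = inner ℝ
      (WithLp.toLp 2 fun j => ∑ i, Y i j * x i : EuclideanSpace ℝ (Fin n))
      (WithLp.toLp 2 fun j => ∑ i, Y i j * y i : EuclideanSpace ℝ (Fin n)) := by
    rw [sampleCov_eq_sum, inner_eq_sum]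
  rw [h, S.toLp_transpose_apply, S.toLp_transpose_apply, S.orthonormal_right.inner_sum]
  refine Finset.sum_congr rfl fun k _ => ?_
  simp
  ring

theorem SVD.right_transpose_apply (k : Fin (min p n)) (x : EuclideanSpace ℝ (Fin p)) :
    ∑ j, S.right k j * ∑ i, Y i j * x i = S.val k * inner ℝ (S.left k) x := by
  have h : ∑ j, S.right k j * ∑ i, Y i j * x i = inner ℝ (S.right k)
      (WithLp.toLp 2 fun j => ∑ i, Y i j * x i : EuclideanSpace ℝ (Fin n)) := by
    rw [inner_eq_sum]
  rw [h, S.toLp_transpose_apply, S.orthonormal_right.inner_right_fintype]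

end SVD

theorem frobenius_norm_sq {m n : ℕ} (M : Matrix (Fin m) (Fin n) ℝ) :
    ‖M‖ ^ 2 = ∑ i, ∑ j, M i j ^ 2 := by
  rw [Matrix.frobenius_norm_def, ← Real.sqrt_eq_rpow, Real.sq_sqrt (by positivity)]
  simp

/-- The squared distance between the term `q û v̂ᵀ` of the shrinkage estimator and the term
`η u (Yᵀ u)ᵀ` of the linear predictor depends on the sample only through `⟪û, u⟫²`, the singular
value and the quadratic form `‖Yᵀ u‖²`. -/
theorem SVD.norm_component_sq {p n : ℕ} {Y : Matrix (Fin p) (Fin n) ℝ} (S : SVD Y)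
    (k : Fin (min p n)) {x : EuclideanSpace ℝ (Fin p)} (hx : ‖x‖ = 1) (q η : ℝ) :
    ‖(Matrix.of fun i j => q * S.left k i * S.right k j - η * x i * ∑ i', Y i' j * x i' :
      Matrix (Fin p) (Fin n) ℝ)‖ ^ 2 =
      q ^ 2 - 2 * q * η * S.val k * inner ℝ (S.left k) x ^ 2 + η ^ 2 * sampleCov Y x x := by
  have h1 : ∑ i, S.left k i * S.left k i = 1 := by
    rw [← inner_eq_sum, real_inner_self_eq_norm_sq, S.orthonormal_left.1, one_pow]
  have h2 : ∑ j, S.right k j * S.right k j = 1 := by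
    rw [← inner_eq_sum, real_inner_self_eq_norm_sq, S.orthonormal_right.1, one_pow]
  have h3 : ∑ i, x i * x i = 1 := by
    rw [← inner_eq_sum, real_inner_self_eq_norm_sq, hx, one_pow]
  have h4 := S.right_transpose_apply k x
  have h5 := sampleCov_eq_sum Y x x
  have h6 := inner_eq_sum (S.left k) x
  rw [frobenius_norm_sq]
  set w : Fin n → ℝ := fun j => ∑ i', Y i' j * x i'
  have expand : ∀ i j, (q * S.left k i * S.right k j - η * x i * w j) ^ 2 =
      q ^ 2 * ((S.left k i * S.left k i) * (S.right k j * S.right k j)) -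
      2 * q * η * ((S.left k i * x i) * (S.right k j * w j)) +
      η ^ 2 * ((x i * x i) * (w j * w j)) := fun i j => by ring
  calc _ = ∑ i, ∑ j, (q * S.left k i * S.right k j - η * x i * w j) ^ 2 := rfl
    _ = q ^ 2 * ((∑ i, S.left k i * S.left k i) * ∑ j, S.right k j * S.right k j) -
      2 * q * η * ((∑ i, S.left k i * x i) * ∑ j, S.right k j * w j) +
      η ^ 2 * ((∑ i, x i * x i) * ∑ j, w j * w j) := by
        simp only [expand, Finset.sum_add_distrib, Finset.sum_sub_distrib, ← Finset.mul_sum,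
          ← Finset.sum_mul]
    _ = _ := by
        rw [h1, h2, h3, h4, h5, h6]
        ring

/-- The predictor `Y ↦ ∑ₖ tₖ² / (1 + tₖ²) uₖ uₖᵀ Y`. -/
noncomputable def linearShrink {p n r : ℕ} (t : Fin r → ℝ) (u : Fin r → EuclideanSpace ℝ (Fin p))
    (Y : Matrix (Fin p) (Fin n) ℝ) : Matrix (Fin p) (Fin n) ℝ :=
  Matrix.of fun i j => ∑ k, t k ^ 2 / (1 + t k ^ 2) * u k i * ∑ i', Y i' j * u k i'

section Limits

variable {r : ℕ} {t : Fin r → ℝ} {p : ℕ → ℕ} {u : ∀ n, Fin r → EuclideanSpace ℝ (Fin (p n))}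
  {Y : ∀ n, Matrix (Fin (p n)) (Fin n) ℝ}

theorem eventually_lt_min (hu : ∀ n, Orthonormal ℝ (u n)) (k : Fin r) :
    ∀ᶠ n in atTop, (k : ℕ) < min (p n) n := by
  filter_upwards [eventually_ge_atTop r] with n hn
  have h : r ≤ p n := by simpa using (hu n).linearIndependent.fintype_card_le_finrank
  exact lt_min (k.2.trans_le h) (k.2.trans_le hn)

theorem tendsto_singularValue_sq (ht : ∀ k, 0 < t k) (hanti : StrictAnti t)
    (hu : ∀ n, Orthonormal ℝ (u n)) (S : ∀ n, SVD (Y n))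
    (hY : Tendsto (fun n => ‖sampleCov (Y n) - populationCov t (u n)‖) atTop (𝓝 0)) (k : Fin r) :
    Tendsto (fun n => (S n).singularValue k ^ 2) atTop (𝓝 (1 + t k ^ 2)) := by
  rw [tendsto_iff_norm_sub_tendsto_zero]
  refine squeeze_zero' (Eventually.of_forall fun n => norm_nonneg _) ?_ hY
  filter_upwards [eventually_lt_min hu k] with n hn
  rw [SVD.singularValue, dif_pos hn]
  exact (eigen_perturbation (hu n) ht hanti (S n).orthonormal_left (fun i => sq_nonneg _)
    (fun i j hij => pow_le_pow_left₀ ((S n).nonneg j) ((S n).antitone hij) 2)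
    (S n).sampleCov_apply le_rfl k hn).1

theorem tendsto_singularValue (ht : ∀ k, 0 < t k) (hanti : StrictAnti t)
    (hu : ∀ n, Orthonormal ℝ (u n)) (S : ∀ n, SVD (Y n))
    (hY : Tendsto (fun n => ‖sampleCov (Y n) - populationCov t (u n)‖) atTop (𝓝 0)) (k : Fin r) :
    Tendsto (fun n => (S n).singularValue k) atTop (𝓝 √(1 + t k ^ 2)) := by
  refine (tendsto_singularValue_sq ht hanti hu S hY k).sqrt.congr' ?_
  filter_upwards [eventually_lt_min hu k] with n hn
  rw [SVD.singularValue, dif_pos hn, Real.sqrt_sq ((S n).nonneg _)]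

/-- The cosine between the `k`-th left singular vector and the `k`-th principal component; it is
set to `0` if there is no such singular vector. -/
noncomputable def SVD.overlap {p n : ℕ} {Y : Matrix (Fin p) (Fin n) ℝ} (S : SVD Y) (k : ℕ)
    (x : EuclideanSpace ℝ (Fin p)) : ℝ :=
  if h : k < min p n then inner ℝ (S.left ⟨k, h⟩) x else 0

theorem tendsto_overlap_sq (ht : ∀ k, 0 < t k) (hanti : StrictAnti t)
    (hu : ∀ n, Orthonormal ℝ (u n)) (S : ∀ n, SVD (Y n))
    (hY : Tendsto (fun n => ‖sampleCov (Y n) - populationCov t (u n)‖) atTop (𝓝 0)) (k : Fin r) :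
    Tendsto (fun n => (S n).overlap k (u n k) ^ 2) atTop (𝓝 1) := by
  obtain ⟨g, hg, hgap, hgap'⟩ := exists_gap ht hanti k
  have hlim : Tendsto (fun n => 1 - (r + 1) *
      (‖sampleCov (Y n) - populationCov t (u n)‖ / g) ^ 2) atTop (𝓝 1) := by
    simpa using (((hY.div_const g).pow 2).const_mul ((r : ℝ) + 1)).const_sub 1
  refine tendsto_of_tendsto_of_tendsto_of_le_of_le' hlim tendsto_const_nhds ?_ ?_
  · filter_upwards [eventually_lt_min hu k, hY.eventually (ge_mem_nhds hg)] with n hn hgn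
    rw [SVD.overlap, dif_pos hn, real_inner_comm]
    have := (eigen_perturbation (hu n) ht hanti (S n).orthonormal_left (fun i => sq_nonneg _)
      (fun i j hij => pow_le_pow_left₀ ((S n).nonneg j) ((S n).antitone hij) 2)
      (S n).sampleCov_apply le_rfl k hn).2 g hg hgn hgap hgap'
    linarith
  · filter_upwards [eventually_lt_min hu k] with n hn
    rw [SVD.overlap, dif_pos hn, sq_le_one_iff_abs_le_one]
    have := abs_real_inner_le_norm ((S n).left ⟨k, hn⟩) (u n k)
    rwa [(S n).orthonormal_left.1, (hu n).1, one_mul] at this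

/-- If the sample covariance approaches the population covariance, then shrinkage of the singular
values to numbers with limits `tₖ² / √(1 + tₖ²)` is asymptotically the same as the linear
predictor. -/
theorem tendsto_norm_shrink_sub_linearShrink (ht : ∀ k, 0 < t k) (hanti : StrictAnti t)
    (hu : ∀ n, Orthonormal ℝ (u n)) (S : ∀ n, SVD (Y n))
    (hY : Tendsto (fun n => ‖sampleCov (Y n) - populationCov t (u n)‖) atTop (𝓝 0))
    {q : ℕ → Fin r → ℝ}
    (hq : ∀ k, Tendsto (fun n => q n k) atTop (𝓝 (t k ^ 2 / √(1 + t k ^ 2)))) :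
    Tendsto (fun n => ‖(S n).shrink (q n) - linearShrink t (u n) (Y n)‖) atTop (𝓝 0) := by
  let η : Fin r → ℝ := fun k => t k ^ 2 / (1 + t k ^ 2)
  let F : ℕ → Fin r → ℝ := fun n k => q n k ^ 2 -
    2 * q n k * η k * (S n).singularValue k * (S n).overlap k (u n k) ^ 2 +
    η k ^ 2 * sampleCov (Y n) (u n k) (u n k)
  have hcov : ∀ k, Tendsto (fun n => sampleCov (Y n) (u n k) (u n k)) atTop
      (𝓝 (1 + t k ^ 2)) := by
    intro k
    rw [tendsto_iff_norm_sub_tendsto_zero]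
    refine squeeze_zero (fun n => norm_nonneg _) (fun n => ?_) hY
    have := (sampleCov (Y n) - populationCov t (u n)).le_opNorm₂ (u n k) (u n k)
    rw [(hu n).1, mul_one, mul_one, sub_apply, sub_apply, populationCov_component (hu n),
      real_inner_self_eq_norm_sq, (hu n).1, one_pow, mul_one] at this
    exact this
  have hF : ∀ k, Tendsto (fun n => F n k) atTop (𝓝 0) := by
    intro k
    have h := (((hq k).pow 2).sub (((((hq k).const_mul 2).mul_const (η k)).mul
      (tendsto_singularValue ht hanti hu S hY k)).mul
      (tendsto_overlap_sq ht hanti hu S hY k))).add ((hcov k).const_mul (η k ^ 2))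
    have hs : √(1 + t k ^ 2) ≠ 0 := by positivity
    have hs2 : √(1 + t k ^ 2) ^ 2 = 1 + t k ^ 2 := Real.sq_sqrt (by positivity)
    have halg : ∀ s a : ℝ, s ≠ 0 →
        (a / s) ^ 2 - 2 * (a / s) * (a / s ^ 2) * s * 1 + (a / s ^ 2) ^ 2 * s ^ 2 = 0 := by
      intro s a hs
      field_simp
      ring
    have h0 := halg _ (t k ^ 2) hs
    rw [hs2] at h0
    rwa [h0] at h
  have hsum : Tendsto (fun n => ∑ k, √(F n k)) atTop (𝓝 0) := by
    have := tendsto_finsetSum Finset.univ fun k (_ : k ∈ Finset.univ) => (hF k).sqrt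
    simpa using this
  refine squeeze_zero' (Eventually.of_forall fun n => norm_nonneg _) ?_ hsum
  filter_upwards [eventually_all.2 fun k => eventually_lt_min hu k] with n hn
  have hdecomp : (S n).shrink (q n) - linearShrink t (u n) (Y n) = ∑ k : Fin r,
      (Matrix.of fun i j => q n k * (S n).left ⟨k, hn k⟩ i * (S n).right ⟨k, hn k⟩ j -
        η k * u n k i * ∑ i', Y n i' j * u n k i' : Matrix (Fin (p n)) (Fin n) ℝ) := by
    ext i j
    simp only [SVD.shrink, linearShrink, Matrix.sub_apply, Matrix.of_apply, Matrix.sum_apply,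
      Finset.sum_sub_distrib, η]
    congr 1
    exact Finset.sum_congr rfl fun k _ => dif_pos (hn k)
  rw [hdecomp]
  refine (norm_sum_le _ _).trans (Finset.sum_le_sum fun k _ => Real.le_sqrt_of_sq_le ?_)
  rw [SVD.norm_component_sq (S n) ⟨k, hn k⟩ ((hu n).1 k)]
  simp only [F, SVD.singularValue, SVD.overlap, dif_pos (hn k)]
  exact le_rfl

end Limits

end SpikedModel

/-! ### Sub-Gaussian variables and concentration -/

section Concentration

variable {Ω : Type*} [MeasurableSpace Ω] {P : Measure Ω}

theorem HasSubgaussianMGF.mono {X : Ω → ℝ} {c d : ℝ≥0} (h : HasSubgaussianMGF X c P)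
    (hcd : c ≤ d) : HasSubgaussianMGF X d P where
  integrable_exp_mul := h.integrable_exp_mul
  mgf_le s := (h.mgf_le s).trans (by gcongr)

theorem HasSubgaussianMGF.finset_sum [IsProbabilityMeasure P] {ι : Type*} (s : Finset ι)
    {X : ι → Ω → ℝ} {c : ι → ℝ≥0} (h : ∀ i, HasSubgaussianMGF (X i) (c i) P) :
    HasSubgaussianMGF (fun ω => ∑ i ∈ s, X i ω) ((∑ i ∈ s, NNReal.sqrt (c i)) ^ 2) P := by
  classical
  induction s using Finset.induction_on with
  | empty => simp
  | insert i s hi ih =>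
    simp only [Finset.sum_insert hi]
    simpa using (h i).add ih

theorem hasSubgaussianMGF_of_map_eq_gaussianReal {X : Ω → ℝ} (hX : AEMeasurable X P) {v : ℝ≥0}
    (h : P.map X = gaussianReal 0 v) : HasSubgaussianMGF X v P := by
  rw [← HasSubgaussianMGF.id_map_iff hX, h]
  exact ⟨fun s => integrable_exp_mul_gaussianReal s, fun s => by simp [mgf_id_gaussianReal]⟩

/-- A bound, independent of the variable, for `E exp (ξ² / (4 K))` when `ξ` is sub-Gaussian with
parameter `K`; see `lintegral_exp_sq_le`. -/
noncomputable def subgaussianSqBound : ℝ :=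
  ∫ g, Real.exp (g ^ 2 / 4) ∂(gaussianReal 0 1)

theorem integrable_exp_sq_div_four_gaussianReal :
    Integrable (fun g : ℝ => Real.exp (g ^ 2 / 4)) (gaussianReal 0 1) := by
  rw [gaussianReal_of_var_ne_zero 0 one_ne_zero, gaussianPDF_def,
    integrable_withDensity_iff (by fun_prop) (by simp)]
  have h := (integrable_exp_neg_mul_sq (b := 1 / 4) (by norm_num)).const_mul (√(2 * Real.pi))⁻¹
  refine h.congr (ae_of_all _ fun x => ?_)
  simp only [gaussianPDFReal, NNReal.coe_one, mul_one, sub_zero]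
  rw [ENNReal.toReal_ofReal (by positivity), mul_left_comm, ← Real.exp_add]
  congr 2
  ring

/-- The square of a sub-Gaussian variable has an exponential moment. With a standard normal `g` that
is independent of `ξ` one has `exp (a² ξ² / 2) = E_g exp (a g ξ)`, and by Tonelli's theorem the
expectation over `ξ` may be taken first. -/
theorem integrable_exp_sq_of_hasSubgaussianMGF [IsProbabilityMeasure P] {ξ : Ω → ℝ} {K : ℝ≥0}
    (hK : 0 < K) (hξ : HasSubgaussianMGF ξ K P) :
    Integrable (fun ω => Real.exp ((4 * K : ℝ)⁻¹ * ξ ω ^ 2)) P ∧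
      ∫ ω, Real.exp ((4 * K : ℝ)⁻¹ * ξ ω ^ 2) ∂P ≤ subgaussianSqBound := by
  have hK' : (0 : ℝ) < K := hK
  -- chosen such that `a ^ 2 / 2 = (4 * K)⁻¹`
  set a : ℝ := √((2 * K : ℝ)⁻¹) with ha
  have ha2 : a ^ 2 = (2 * K : ℝ)⁻¹ := Real.sq_sqrt (by positivity)
  have hmeas : AEMeasurable ξ P := hξ.aemeasurable
  have hgauss : ∀ x : ℝ, ENNReal.ofReal (Real.exp ((4 * K : ℝ)⁻¹ * x ^ 2)) =
      ∫⁻ g, ENNReal.ofReal (Real.exp (a * x * g)) ∂(gaussianReal 0 1) := by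
    intro x
    rw [← ofReal_integral_eq_lintegral_ofReal (integrable_exp_mul_gaussianReal _)
      (ae_of_all _ fun _ => (Real.exp_pos _).le)]
    have := congrFun (mgf_id_gaussianReal (μ := 0) (v := 1)) (a * x)
    simp only [mgf, id] at this
    rw [this, mul_pow, ha2]
    congr 2
    push_cast
    field_simp
    ring
  have hlint : ∫⁻ ω, ENNReal.ofReal (Real.exp ((4 * K : ℝ)⁻¹ * ξ ω ^ 2)) ∂P ≤
      ENNReal.ofReal subgaussianSqBound := by
    simp only [hgauss]
    rw [lintegral_lintegral_swap]
    · rw [subgaussianSqBound, ofReal_integral_eq_lintegral_ofReal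
        integrable_exp_sq_div_four_gaussianReal (ae_of_all _ fun _ => (Real.exp_pos _).le)]
      refine lintegral_mono fun g => ?_
      have hcomm : ∀ ω, a * ξ ω * g = a * g * ξ ω := fun ω => by ring
      simp only [hcomm]
      rw [← ofReal_integral_eq_lintegral_ofReal (hξ.integrable_exp_mul _)
        (ae_of_all _ fun _ => (Real.exp_pos _).le)]
      refine ENNReal.ofReal_le_ofReal ((hξ.mgf_le (a * g)).trans_eq ?_)
      rw [mul_pow, ha2]
      congr 1
      field_simp
      ring
    · have h1 : AEMeasurable (fun z : Ω × ℝ => ξ z.1) (P.prod (gaussianReal 0 1)) :=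
        hmeas.comp_fst
      exact (Real.measurable_exp.comp_aemeasurable
        ((h1.const_mul a).mul measurable_snd.aemeasurable)).ennreal_ofReal
  have hsm : AEStronglyMeasurable (fun ω => Real.exp ((4 * K : ℝ)⁻¹ * ξ ω ^ 2)) P :=
    (Real.measurable_exp.comp_aemeasurable ((hmeas.pow_const 2).const_mul _)).aestronglyMeasurable
  have hint : Integrable (fun ω => Real.exp ((4 * K : ℝ)⁻¹ * ξ ω ^ 2)) P :=
    (lintegral_ofReal_ne_top_iff_integrable hsm (ae_of_all _ fun _ => (Real.exp_pos _).le)).1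
      (ne_top_of_le_ne_top ENNReal.ofReal_ne_top hlint)
  refine ⟨hint, ?_⟩
  rw [← ofReal_integral_eq_lintegral_ofReal hint (ae_of_all _ fun _ => (Real.exp_pos _).le)] at hlint
  exact (ENNReal.ofReal_le_ofReal_iff (integral_nonneg fun _ => (Real.exp_pos _).le)).1 hlint

/-- A second order bound for the moment generating function of a centered variable with an
exponential moment. -/
theorem mgf_le_of_exp_abs [IsProbabilityMeasure P] {η : Ω → ℝ} (hη : AEMeasurable η P)
    {a M : ℝ} (ha : 0 < a) (hint : Integrable (fun ω => Real.exp (a * |η ω|)) P)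
    (hM : ∫ ω, Real.exp (a * |η ω|) ∂P ≤ M) (hmean : ∫ ω, η ω ∂P = 0) {l : ℝ}
    (hl : |l| ≤ a / 2) :
    Integrable (fun ω => Real.exp (l * η ω)) P ∧ mgf η P l ≤ Real.exp (8 * M / a ^ 2 * l ^ 2) := by
  have hsm : ∀ s : ℝ, AEStronglyMeasurable (fun ω => Real.exp (s * η ω)) P := fun s =>
    (Real.measurable_exp.comp_aemeasurable (hη.const_mul s)).aestronglyMeasurable
  have hexp : Integrable (fun ω => Real.exp (l * η ω)) P := by
    refine hint.mono' (hsm l) (ae_of_all _ fun ω => ?_)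
    rw [Real.norm_eq_abs, Real.abs_exp, Real.exp_le_exp]
    calc l * η ω ≤ |l| * |η ω| := (le_abs_self _).trans (abs_mul _ _).le
      _ ≤ a * |η ω| := by gcongr; linarith
  have hηint : Integrable η P := by
    refine (hint.const_mul a⁻¹).mono' hη.aestronglyMeasurable (ae_of_all _ fun ω => ?_)
    rw [Real.norm_eq_abs, ← div_eq_inv_mul, le_div_iff₀ ha]
    linarith [Real.add_one_le_exp (a * |η ω|)]
  refine ⟨hexp, ?_⟩
  have hpt : ∀ x : ℝ, Real.exp (l * x) ≤ 1 + l * x + 8 / a ^ 2 * l ^ 2 * Real.exp (a * |x|) := by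
    intro x
    have h1 : Real.exp (l * x) ≤ 1 + l * x + |l * x| ^ 2 * Real.exp |l * x| := by
      have := Complex.norm_exp_sub_sum_le_norm_mul_exp ((l * x : ℝ) : ℂ) 2
      rw [Finset.sum_range_succ, Finset.sum_range_one] at this
      have e : Complex.exp ((l * x : ℝ) : ℂ) - (((l * x : ℝ) : ℂ) ^ 0 / (Nat.factorial 0 : ℕ) +
          ((l * x : ℝ) : ℂ) ^ 1 / (Nat.factorial 1 : ℕ)) =
          ((Real.exp (l * x) - (1 + l * x) : ℝ) : ℂ) := by
        push_cast
        simp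
      rw [e, Complex.norm_real, Complex.norm_real, Real.norm_eq_abs, Real.norm_eq_abs] at this
      linarith [le_abs_self (Real.exp (l * x) - (1 + l * x))]
    have h2 : |l * x| ^ 2 * Real.exp |l * x| ≤ 8 / a ^ 2 * l ^ 2 * Real.exp (a * |x|) := by
      have h3 : Real.exp |l * x| ≤ Real.exp (a / 2 * |x|) := by
        rw [abs_mul]
        gcongr
      have h4 : (a / 2 * |x|) ^ 2 / 2 ≤ Real.exp (a / 2 * |x|) := by
        have := Real.quadratic_le_exp_of_nonneg (x := a / 2 * |x|) (by positivity)
        have : 0 ≤ a / 2 * |x| := by positivity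
        linarith
      have h5 : |l * x| ^ 2 ≤ 8 / a ^ 2 * l ^ 2 * Real.exp (a / 2 * |x|) := by
        calc |l * x| ^ 2 = 8 / a ^ 2 * l ^ 2 * ((a / 2 * |x|) ^ 2 / 2) := by
              rw [abs_mul, mul_pow, mul_pow, sq_abs, sq_abs]
              field_simp
              ring
          _ ≤ _ := by gcongr
      calc |l * x| ^ 2 * Real.exp |l * x|
          ≤ 8 / a ^ 2 * l ^ 2 * Real.exp (a / 2 * |x|) * Real.exp (a / 2 * |x|) := by gcongr
        _ = 8 / a ^ 2 * l ^ 2 * Real.exp (a * |x|) := by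
            rw [mul_assoc, ← Real.exp_add]
            congr 2
            ring
    linarith
  have hint2 : Integrable (fun ω => l * η ω + 8 / a ^ 2 * l ^ 2 * Real.exp (a * |η ω|)) P :=
    (hηint.const_mul l).add (hint.const_mul _)
  calc mgf η P l ≤ ∫ ω, 1 + (l * η ω + 8 / a ^ 2 * l ^ 2 * Real.exp (a * |η ω|)) ∂P := by
        refine integral_mono hexp ((integrable_const 1).add hint2) fun ω => ?_
        have := hpt (η ω)
        linarith
    _ = 1 + 8 / a ^ 2 * l ^ 2 * ∫ ω, Real.exp (a * |η ω|) ∂P := by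
        rw [integral_add (integrable_const 1) hint2, integral_add (hηint.const_mul l)
          (hint.const_mul _), integral_const_mul, integral_const_mul, hmean]
        simp
    _ ≤ 1 + 8 / a ^ 2 * l ^ 2 * M := by gcongr
    _ ≤ Real.exp (8 / a ^ 2 * l ^ 2 * M) := by
        linarith [Real.add_one_le_exp (8 / a ^ 2 * l ^ 2 * M)]
    _ = _ := by congr 1; ring

/-- **Bernstein's inequality**, without explicit constants: a sum of `n` independent centered
variables with uniformly bounded exponential moments exceeds `ε n` with a probability that is
exponentially small in `n`. -/
theorem exists_exp_tail_bound {a M ε : ℝ} (ha : 0 < a) (hM : 0 < M) (hε : 0 < ε) :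
    ∃ c > 0, ∀ {Ω : Type*} [MeasurableSpace Ω] (P : Measure Ω) [IsProbabilityMeasure P] (n : ℕ)
      (η : Fin n → Ω → ℝ), (∀ j, Measurable (η j)) → iIndepFun η P →
      (∀ j, ∫ ω, η j ω ∂P = 0) → (∀ j, Integrable (fun ω => Real.exp (a * |η j ω|)) P) →
      (∀ j, ∫ ω, Real.exp (a * |η j ω|) ∂P ≤ M) →
      P.real {ω | ε * n ≤ |∑ j, η j ω|} ≤ 2 * Real.exp (-(c * n)) := by
  set C := 8 * M / a ^ 2 with hC
  have hCpos : 0 < C := by positivity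
  -- at this point the quadratic term of the exponent is at most half of the linear one
  set l := min (a / 2) (ε / (2 * C)) with hl
  have hlpos : 0 < l := by positivity
  refine ⟨l * ε / 2, by positivity, ?_⟩
  intro Ω _ P _ n η hmeas hindep hmean hint hbound
  have hlC : C * l ^ 2 ≤ l * ε / 2 := by
    have : l * (2 * C) ≤ ε := by
      rw [← le_div_iff₀ (by positivity)]
      exact min_le_right _ _
    nlinarith
  have hside : ∀ s : ℝ, |s| = l → Integrable (fun ω => Real.exp (s * (∑ j, η j) ω)) P ∧
      mgf (∑ j, η j) P s ≤ Real.exp (n * (C * l ^ 2)) := by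
    intro s hs
    have hs' : |s| ≤ a / 2 := hs.trans_le (min_le_left _ _)
    have h := fun j => mgf_le_of_exp_abs (hmeas j).aemeasurable ha (hint j) (hbound j) (hmean j) hs'
    refine ⟨hindep.integrable_exp_mul_sum hmeas fun j _ => (h j).1, ?_⟩
    rw [hindep.mgf_sum hmeas, Real.exp_nat_mul]
    calc ∏ j, mgf (η j) P s ≤ ∏ j : Fin n, Real.exp (C * l ^ 2) := by
          refine Finset.prod_le_prod (fun j _ => mgf_nonneg) fun j _ => ?_
          rw [← hs, sq_abs]
          exact (h j).2
      _ = Real.exp (C * l ^ 2) ^ n := by simp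
  have hup : P.real {ω | ε * n ≤ (∑ j, η j) ω} ≤ Real.exp (-(l * ε / 2 * n)) := by
    have h := hside l (abs_of_pos hlpos)
    refine (measure_ge_le_exp_mul_mgf (ε * n) hlpos.le h.1).trans ?_
    calc _ ≤ Real.exp (-l * (ε * n)) * Real.exp (n * (C * l ^ 2)) := by gcongr; exact h.2
      _ ≤ _ := by
        rw [← Real.exp_add, Real.exp_le_exp]
        nlinarith [mul_le_mul_of_nonneg_left hlC (Nat.cast_nonneg (α := ℝ) n)]
  have hlow : P.real {ω | (∑ j, η j) ω ≤ -(ε * n)} ≤ Real.exp (-(l * ε / 2 * n)) := by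
    have h := hside (-l) (by rw [abs_neg, abs_of_pos hlpos])
    refine (measure_le_le_exp_mul_mgf (-(ε * n)) (neg_nonpos.2 hlpos.le) h.1).trans ?_
    calc _ ≤ Real.exp (- -l * -(ε * n)) * Real.exp (n * (C * l ^ 2)) := by gcongr; exact h.2
      _ ≤ _ := by
        rw [← Real.exp_add, Real.exp_le_exp]
        nlinarith [mul_le_mul_of_nonneg_left hlC (Nat.cast_nonneg (α := ℝ) n)]
  have hsub : {ω | ε * n ≤ |∑ j, η j ω|} ⊆
      {ω | ε * n ≤ (∑ j, η j) ω} ∪ {ω | (∑ j, η j) ω ≤ -(ε * n)} := by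
    intro ω hω
    simp only [Set.mem_union, Set.mem_ofPred_eq, Finset.sum_apply] at hω ⊢
    rcases le_abs.1 hω with h | h
    · exact Or.inl h
    · exact Or.inr (by linarith)
  calc _ ≤ P.real ({ω | ε * n ≤ (∑ j, η j) ω} ∪ {ω | (∑ j, η j) ω ≤ -(ε * n)}) :=
        measureReal_mono hsub
    _ ≤ _ := (measureReal_union_le _ _).trans (by linarith)

/-- The centered product of two sub-Gaussian variables has an exponential moment. -/
theorem integrable_exp_abs_mul_sub_integral [IsProbabilityMeasure P] {ξ ζ : Ω → ℝ} {K : ℝ≥0}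
    (hK : 0 < K) (hξ : HasSubgaussianMGF ξ K P) (hζ : HasSubgaussianMGF ζ K P) :
    Integrable (fun ω => Real.exp ((4 * K : ℝ)⁻¹ * |ξ ω * ζ ω - ∫ ω', ξ ω' * ζ ω' ∂P|)) P ∧
      ∫ ω, Real.exp ((4 * K : ℝ)⁻¹ * |ξ ω * ζ ω - ∫ ω', ξ ω' * ζ ω' ∂P|) ∂P ≤
        subgaussianSqBound * Real.exp subgaussianSqBound := by
  have hK' : (0 : ℝ) < K := hK
  set a : ℝ := (4 * K : ℝ)⁻¹ with ha
  have hapos : 0 < a := by positivity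
  obtain ⟨h1, h1'⟩ := integrable_exp_sq_of_hasSubgaussianMGF hK hξ
  obtain ⟨h2, h2'⟩ := integrable_exp_sq_of_hasSubgaussianMGF hK hζ
  have hprodm : AEMeasurable (fun ω => ξ ω * ζ ω) P := hξ.aemeasurable.mul hζ.aemeasurable
  have hpt : ∀ ω, Real.exp (a * |ξ ω * ζ ω|) ≤
      (Real.exp (a * ξ ω ^ 2) + Real.exp (a * ζ ω ^ 2)) / 2 := by
    intro ω
    have e1 : a * |ξ ω * ζ ω| ≤ a * ξ ω ^ 2 / 2 + a * ζ ω ^ 2 / 2 := by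
      rw [abs_mul]
      nlinarith [mul_nonneg hapos.le (sq_nonneg (|ξ ω| - |ζ ω|)), sq_abs (ξ ω), sq_abs (ζ ω)]
    have e2 : Real.exp (a * ξ ω ^ 2) = Real.exp (a * ξ ω ^ 2 / 2) ^ 2 := by
      rw [← Real.exp_nat_mul]; congr 1; push_cast; ring
    have e3 : Real.exp (a * ζ ω ^ 2) = Real.exp (a * ζ ω ^ 2 / 2) ^ 2 := by
      rw [← Real.exp_nat_mul]; congr 1; push_cast; ring
    have e4 := Real.exp_le_exp.2 e1
    rw [Real.exp_add] at e4
    rw [e2, e3]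
    nlinarith [sq_nonneg (Real.exp (a * ξ ω ^ 2 / 2) - Real.exp (a * ζ ω ^ 2 / 2))]
  have hexpm : ∀ b : ℝ, AEStronglyMeasurable (fun ω => Real.exp (a * |ξ ω * ζ ω - b|)) P :=
    fun b => (Real.measurable_exp.comp_aemeasurable
      ((continuous_abs.measurable.comp_aemeasurable (hprodm.sub_const b)).const_mul a)
      ).aestronglyMeasurable
  have hint : Integrable (fun ω => Real.exp (a * |ξ ω * ζ ω|)) P := by
    refine ((h1.add h2).div_const 2).mono' (by simpa using hexpm 0) (ae_of_all _ fun ω => ?_)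
    rw [Real.norm_eq_abs, Real.abs_exp]
    exact hpt ω
  have hle : ∫ ω, Real.exp (a * |ξ ω * ζ ω|) ∂P ≤ subgaussianSqBound := by
    calc _ ≤ ∫ ω, (Real.exp (a * ξ ω ^ 2) + Real.exp (a * ζ ω ^ 2)) / 2 ∂P :=
          integral_mono hint ((h1.add h2).div_const 2) hpt
      _ ≤ _ := by
        rw [integral_div, integral_add h1 h2]
        linarith
  have hprod : Integrable (fun ω => ξ ω * ζ ω) P := by
    refine (hint.const_mul a⁻¹).mono' hprodm.aestronglyMeasurable (ae_of_all _ fun ω => ?_)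
    rw [Real.norm_eq_abs, ← div_eq_inv_mul, le_div_iff₀ hapos]
    linarith [Real.add_one_le_exp (a * |ξ ω * ζ ω|)]
  have hmean : a * |∫ ω, ξ ω * ζ ω ∂P| ≤ subgaussianSqBound := by
    calc a * |∫ ω, ξ ω * ζ ω ∂P| ≤ a * ∫ ω, |ξ ω * ζ ω| ∂P := by
          gcongr
          exact abs_integral_le_integral_abs
      _ = ∫ ω, a * |ξ ω * ζ ω| ∂P := by rw [integral_const_mul]
      _ ≤ ∫ ω, Real.exp (a * |ξ ω * ζ ω|) ∂P := integral_mono (hprod.abs.const_mul a) hint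
          fun ω => by
            have := Real.add_one_le_exp (a * |ξ ω * ζ ω|)
            show a * |ξ ω * ζ ω| ≤ Real.exp (a * |ξ ω * ζ ω|)
            linarith
      _ ≤ _ := hle
  set m := ∫ ω, ξ ω * ζ ω ∂P
  have hpt2 : ∀ ω, Real.exp (a * |ξ ω * ζ ω - m|) ≤
      Real.exp (a * |ξ ω * ζ ω|) * Real.exp subgaussianSqBound := by
    intro ω
    rw [← Real.exp_add, Real.exp_le_exp]
    calc a * |ξ ω * ζ ω - m| ≤ a * (|ξ ω * ζ ω| + |m|) := by gcongr; exact abs_sub _ _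
      _ ≤ _ := by linarith
  have hint2 : Integrable (fun ω => Real.exp (a * |ξ ω * ζ ω - m|)) P := by
    refine (hint.mul_const (Real.exp subgaussianSqBound)).mono' (hexpm m) (ae_of_all _ fun ω => ?_)
    rw [Real.norm_eq_abs, Real.abs_exp]
    exact hpt2 ω
  refine ⟨hint2, ?_⟩
  calc _ ≤ ∫ ω, Real.exp (a * |ξ ω * ζ ω|) * Real.exp subgaussianSqBound ∂P :=
        integral_mono hint2 (hint.mul_const _) hpt2
    _ ≤ _ := by
      rw [integral_mul_const]
      gcongr

theorem subgaussianSqBound_pos : 0 < subgaussianSqBound :=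
  integral_exp_pos integrable_exp_sq_div_four_gaussianReal

end Concentration

/-! ### Independence of the columns -/

section Independence

variable {Ω : Type*} [MeasurableSpace Ω] {P : Measure Ω} [IsProbabilityMeasure P]

/-- Independence may be checked on `π`-systems that generate the target `σ`-algebras. -/
theorem iIndepFun_of_generateFrom {ι β : Type*} [mβ : MeasurableSpace β] {f : ι → Ω → β}
    (hf : ∀ i, Measurable (f i)) {C : Set (Set β)} (hC : mβ = MeasurableSpace.generateFrom C)
    (hpi : IsPiSystem C)
    (h : ∀ (S : Finset ι) (A : ι → Set β), (∀ i, A i ∈ C) →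
      P (⋂ i ∈ S, f i ⁻¹' A i) = ∏ i ∈ S, P (f i ⁻¹' A i)) : iIndepFun f P := by
  classical
  rw [iIndepFun_iff_iIndep]
  refine iIndepSets.iIndep (fun i => (hf i).comap_le)
    (fun i => Set.preimage (f i) '' C) (fun i => ?_) (fun i => ?_) ?_
  · exact hpi.comap (f i)
  · conv_lhs => rw [hC]
    exact MeasurableSpace.comap_generateFrom
  · rw [iIndepSets_iff]
    intro S F hF
    rcases S.eq_empty_or_nonempty with rfl | ⟨i₀, hi₀⟩
    · simp
    choose! A hAC hA using hF
    have h' := h S (fun i => if i ∈ S then A i else A i₀) fun i => by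
      split_ifs with hi
      · exact hAC i hi
      · exact hAC i₀ hi₀
    have e : ∀ i ∈ S, f i ⁻¹' (if i ∈ S then A i else A i₀) = F i := fun i hi => by
      rw [if_pos hi, hA i hi]
    rwa [Set.iInter₂_congr e, Finset.prod_congr rfl fun i hi => by rw [e i hi]] at h'

/-- Two independent families of independent variables give a family of independent pairs. -/
theorem iIndepFun.prodMk_of_indepFun {ι α β : Type*} [MeasurableSpace α]
    [MeasurableSpace β] {f : ι → Ω → α} {g : ι → Ω → β} (hf : ∀ i, Measurable (f i))
    (hg : ∀ i, Measurable (g i)) (hfi : iIndepFun f P) (hgi : iIndepFun g P)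
    (hfg : IndepFun (fun ω i => f i ω) (fun ω i => g i ω) P) :
    iIndepFun (fun i ω => (f i ω, g i ω)) P := by
  refine iIndepFun_of_generateFrom (fun i => (hf i).prodMk (hg i)) generateFrom_prod.symm
    isPiSystem_prod fun S A hA => ?_
  choose s hs t ht hst using hA
  have hpair : ∀ i, (fun ω => (f i ω, g i ω)) ⁻¹' A i = f i ⁻¹' s i ∩ g i ⁻¹' t i := fun i => by
    rw [← hst i]; rfl
  have hinter : ⋂ i ∈ S, (fun ω => (f i ω, g i ω)) ⁻¹' A i =
      (fun ω i => f i ω) ⁻¹' (⋂ i ∈ S, Function.eval i ⁻¹' s i) ∩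
      (fun ω i => g i ω) ⁻¹' (⋂ i ∈ S, Function.eval i ⁻¹' t i) := by
    ext ω
    simp only [hpair, Set.mem_iInter, Set.mem_inter_iff, Set.mem_preimage, Function.eval]
    exact ⟨fun h => ⟨fun i hi => (h i hi).1, fun i hi => (h i hi).2⟩,
      fun h i hi => ⟨h.1 i hi, h.2 i hi⟩⟩
  have hsm : MeasurableSet (⋂ i ∈ S, Function.eval (β := fun _ => α) i ⁻¹' s i) :=
    Finset.measurableSet_biInter S fun i _ => measurable_pi_apply i (hs i)
  have htm : MeasurableSet (⋂ i ∈ S, Function.eval (β := fun _ => β) i ⁻¹' t i) :=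
    Finset.measurableSet_biInter S fun i _ => measurable_pi_apply i (ht i)
  have hone : ∀ i, P ((fun ω => (f i ω, g i ω)) ⁻¹' A i) = P (f i ⁻¹' s i) * P (g i ⁻¹' t i) := by
    intro i
    rw [hpair]
    exact (hfg.comp (measurable_pi_apply i) (measurable_pi_apply i)).measure_inter_preimage_eq_mul
      _ _ (hs i) (ht i)
  have hfS := hfi.measure_inter_preimage_eq_mul S fun i _ => hs i
  have hgS := hgi.measure_inter_preimage_eq_mul S fun i _ => ht i
  have e1 : (fun ω i => f i ω) ⁻¹' (⋂ i ∈ S, Function.eval i ⁻¹' s i) = ⋂ i ∈ S, f i ⁻¹' s i := by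
    simp only [Set.preimage_iInter]; rfl
  have e2 : (fun ω i => g i ω) ⁻¹' (⋂ i ∈ S, Function.eval i ⁻¹' t i) = ⋂ i ∈ S, g i ⁻¹' t i := by
    simp only [Set.preimage_iInter]; rfl
  rw [hinter, hfg.measure_inter_preimage_eq_mul _ _ hsm htm, e1, e2, hfS, hgS,
    ← Finset.prod_mul_distrib]
  exact Finset.prod_congr rfl fun i _ => (hone i).symm

/-- The columns of a matrix with independent entries are independent. -/
theorem iIndepFun.curry_right {ι κ β : Type*} [Fintype ι] [MeasurableSpace β]
    {f : ι → κ → Ω → β} (hf : ∀ i j, Measurable (f i j))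
    (h : iIndepFun (fun (ij : ι × κ) ω => f ij.1 ij.2 ω) P) :
    iIndepFun (fun j ω i => f i j ω) P := by
  classical
  refine iIndepFun_of_generateFrom (fun j => measurable_pi_lambda _ fun i => hf i j)
    generateFrom_pi.symm isPiSystem_pi fun S A hA => ?_
  choose s hs hsA using hA
  have hs' : ∀ j i, MeasurableSet (s j i) := fun j i => hs j i (Set.mem_univ i)
  have hpre : ∀ j, (fun ω i => f i j ω) ⁻¹' A j = ⋂ i, f i j ⁻¹' s j i := fun j => by
    rw [← hsA j]
    ext ω
    simp
  have hone : ∀ j, P ((fun ω i => f i j ω) ⁻¹' A j) = ∏ i, P (f i j ⁻¹' s j i) := by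
    intro j
    rw [hpre]
    have h' := h.precomp (g := fun i => (i, j)) (Prod.mk_left_injective j)
    simpa using h'.measure_inter_preimage_eq_mul Finset.univ fun i _ => hs' j i
  have hall := h.measure_inter_preimage_eq_mul (Finset.univ ×ˢ S)
    (sets := fun ij => s ij.2 ij.1) fun ij _ => hs' ij.2 ij.1
  have hset : ⋂ j ∈ S, (fun ω i => f i j ω) ⁻¹' A j =
      ⋂ ij ∈ Finset.univ ×ˢ S, (fun ω => f (ij : ι × κ).1 ij.2 ω) ⁻¹' s ij.2 ij.1 := by
    ext ω
    simp only [hpre, Set.mem_iInter, Set.mem_preimage, Finset.mem_product, Finset.mem_univ,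
      true_and, Prod.forall]
    exact ⟨fun H i j hj => H j hj i, fun H j hj i => H i j hj⟩
  rw [hset, hall, Finset.prod_product_right]
  exact Finset.prod_congr rfl fun j _ => (hone j).symm

end Independence

namespace SpikedModel

/-! ### The columns of the observed matrix -/

section Model

variable {p n r : ℕ}

theorem col_add (M N : Matrix (Fin p) (Fin n) ℝ) (j : Fin n) :
    col (M + N) j = col M j + col N j := by
  ext i
  simp [col, mul_add]

theorem col_signal (t : Fin r → ℝ) (u : Fin r → EuclideanSpace ℝ (Fin p)) (z : Fin n → Fin r → ℝ)
    (j : Fin n) : col (signal t u z) j = ∑ k, (t k * z j k) • u k := by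
  have hn : √(n : ℝ) ≠ 0 := (Real.sqrt_pos.2 (Nat.cast_pos.2 j.pos)).ne'
  ext i
  simp [col, signal]
  field_simp

/-- The coefficients of the signal and the entries of the noise that determine the `j`-th column of
the observed matrix, as one family. -/
def sources (z : Fin n → Fin r → ℝ) (G : Matrix (Fin p) (Fin n) ℝ) (j : Fin n) :
    Fin r ⊕ Fin p → ℝ :=
  Sum.elim (z j) fun i => G i j

/-- The coordinates with respect to `sources` of the inner product of `x` with a column of the
signal. -/
noncomputable def signalCoeff (t : Fin r → ℝ) (u : Fin r → EuclideanSpace ℝ (Fin p))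
    (x : EuclideanSpace ℝ (Fin p)) : Fin r ⊕ Fin p → ℝ :=
  Sum.elim (fun k => t k * inner ℝ x (u k)) 0

/-- The coordinates with respect to `sources` of the inner product of `x` with a column of the
observed matrix. -/
noncomputable def observedCoeff (n : ℕ) (t : Fin r → ℝ) (u : Fin r → EuclideanSpace ℝ (Fin p))
    (x : EuclideanSpace ℝ (Fin p)) : Fin r ⊕ Fin p → ℝ :=
  Sum.elim (fun k => t k * inner ℝ x (u k)) fun i => √n * x i

theorem inner_col_signal (t : Fin r → ℝ) (u : Fin r → EuclideanSpace ℝ (Fin p))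
    (z : Fin n → Fin r → ℝ) (G : Matrix (Fin p) (Fin n) ℝ) (x : EuclideanSpace ℝ (Fin p))
    (j : Fin n) :
    inner ℝ x (col (signal t u z) j) = ∑ a, signalCoeff t u x a * sources z G j a := by
  rw [col_signal, inner_sum]
  simp only [real_inner_smul_right, Fintype.sum_sum_type, signalCoeff, sources, Sum.elim_inl,
    Sum.elim_inr, Pi.zero_apply, zero_mul, Finset.sum_const_zero, add_zero]
  exact Finset.sum_congr rfl fun k _ => by ring

theorem inner_col_observed (t : Fin r → ℝ) (u : Fin r → EuclideanSpace ℝ (Fin p))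
    (z : Fin n → Fin r → ℝ) (G : Matrix (Fin p) (Fin n) ℝ) (x : EuclideanSpace ℝ (Fin p))
    (j : Fin n) :
    inner ℝ x (col (signal t u z + G) j) = ∑ a, observedCoeff n t u x a * sources z G j a := by
  rw [col_add, inner_add_right, inner_col_signal t u z G, inner_col]
  simp only [Fintype.sum_sum_type, signalCoeff, observedCoeff, sources, Sum.elim_inl,
    Sum.elim_inr, Pi.zero_apply, zero_mul, Finset.sum_const_zero, add_zero, Finset.mul_sum]
  congr 1
  exact Finset.sum_congr rfl fun i _ => by ring

variable {Ω : Type*} [MeasurableSpace Ω] {P : Measure Ω}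
  {z : Ω → Fin n → Fin r → ℝ} {G : Ω → Matrix (Fin p) (Fin n) ℝ}

/-- The probabilistic assumptions on the coefficients and the noise for a fixed sample size. -/
structure IsModel (P : Measure Ω) (K : ℝ≥0) (z : Ω → Fin n → Fin r → ℝ)
    (G : Ω → Matrix (Fin p) (Fin n) ℝ) : Prop where
  meas_z : ∀ j k, Measurable fun ω => z ω j k
  indep_z : iIndepFun (fun (j : Fin n) ω => z ω j) P
  mean_z : ∀ j k, ∫ ω, z ω j k ∂P = 0
  cov_z : ∀ j k l, ∫ ω, z ω j k * z ω j l ∂P = if k = l then 1 else 0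
  subG_z : ∀ j k, HasSubgaussianMGF (fun ω => z ω j k) K P
  meas_G : ∀ i j, Measurable fun ω => G ω i j
  law_G : ∀ i j, P.map (fun ω => G ω i j) = gaussianReal 0 ((n : ℝ≥0)⁻¹)
  indep_G : iIndepFun (fun (ij : Fin p × Fin n) ω => G ω ij.1 ij.2) P
  indep_zG : IndepFun (fun ω j k => z ω j k) (fun ω i j => G ω i j) P

namespace IsModel

variable {K : ℝ≥0}

theorem subG_G (h : IsModel P K z G) (i : Fin p) (j : Fin n) : HasSubgaussianMGF (fun ω => G ω i j) (n : ℝ≥0)⁻¹ P :=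
  hasSubgaussianMGF_of_map_eq_gaussianReal (h.meas_G i j).aemeasurable (h.law_G i j)

theorem measurable_sources (h : IsModel P K z G) (j : Fin n) (a : Fin r ⊕ Fin p) :
    Measurable fun ω => sources (z ω) (G ω) j a := by
  rcases a with k | i
  · exact h.meas_z j k
  · exact h.meas_G i j

theorem memLp_sources [IsProbabilityMeasure P] (h : IsModel P K z G) (j : Fin n) (a : Fin r ⊕ Fin p) :
    MemLp (fun ω => sources (z ω) (G ω) j a) 2 P := by
  rcases a with k | i
  · exact (h.subG_z j k).memLp 2
  · exact (h.subG_G i j).memLp 2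

theorem mean_G (h : IsModel P K z G) (i : Fin p) (j : Fin n) : ∫ ω, G ω i j ∂P = 0 := by
  have := integral_map (μ := P) (h.meas_G i j).aemeasurable (f := fun x : ℝ => x)
    measurable_id.aestronglyMeasurable
  rw [← this, h.law_G, integral_id_gaussianReal]

theorem second_moment_G (h : IsModel P K z G) (i : Fin p) (j : Fin n) :
    ∫ ω, G ω i j * G ω i j ∂P = (n : ℝ)⁻¹ := by
  have h1 := integral_map (μ := P) (h.meas_G i j).aemeasurable (f := fun x : ℝ => x * x)
    (measurable_id.mul measurable_id).aestronglyMeasurable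
  have h2 := variance_of_integral_eq_zero (μ := gaussianReal 0 ((n : ℝ≥0)⁻¹)) (X := fun x : ℝ => x)
    measurable_id.aemeasurable integral_id_gaussianReal
  rw [variance_fun_id_gaussianReal] at h2
  rw [← h1, h.law_G]
  simp only [← pow_two]
  rw [← h2]
  simp

theorem memLp_inner_col_observed [IsProbabilityMeasure P] (h : IsModel P K z G) (j : Fin n)
    {t : Fin r → ℝ} {u : Fin r → EuclideanSpace ℝ (Fin p)} (x : EuclideanSpace ℝ (Fin p)) :
    MemLp (fun ω => inner ℝ x (col (signal t u (z ω) + G ω) j)) 2 P := by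
  simp only [inner_col_observed]
  exact memLp_finsetSum _ fun a _ => (h.memLp_sources j a).const_mul _

theorem memLp_inner_col_signal [IsProbabilityMeasure P] (h : IsModel P K z G) (j : Fin n)
    {t : Fin r → ℝ} {u : Fin r → EuclideanSpace ℝ (Fin p)} (x : EuclideanSpace ℝ (Fin p)) :
    MemLp (fun ω => inner ℝ x (col (signal t u (z ω)) j)) 2 P := by
  simp only [fun ω => inner_col_signal t u (z ω) (G ω) x j]
  exact memLp_finsetSum _ fun a _ => (h.memLp_sources j a).const_mul _

/-- The sources are uncorrelated. -/
theorem integral_sources_mul (h : IsModel P K z G) (j : Fin n) (a b : Fin r ⊕ Fin p) :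
    ∫ ω, sources (z ω) (G ω) j a * sources (z ω) (G ω) j b ∂P =
      if a = b then Sum.elim (fun _ : Fin r => (1 : ℝ)) (fun _ : Fin p => (n : ℝ)⁻¹) a else 0 := by
  have hzG : ∀ k i, ∫ ω, z ω j k * G ω i j ∂P = 0 := by
    intro k i
    have hi : IndepFun (fun ω => z ω j k) (fun ω => G ω i j) P :=
      h.indep_zG.comp (φ := fun x : Fin n → Fin r → ℝ => x j k)
        (ψ := fun x : Fin p → Fin n → ℝ => x i j) (by fun_prop) (by fun_prop)
    rw [hi.integral_fun_mul_eq_mul_integral (h.meas_z j k).aestronglyMeasurable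
      (h.meas_G i j).aestronglyMeasurable, h.mean_z, zero_mul]
  rcases a with k | i <;> rcases b with l | i'
  · simp [sources, h.cov_z]
  · simp [sources, hzG]
  · simp only [sources, Sum.elim_inl, Sum.elim_inr, mul_comm (G _ _ _), hzG]
    simp
  · simp only [sources, Sum.elim_inr, Sum.inr.injEq]
    split_ifs with hii
    · rw [hii, h.second_moment_G]
    · have hi : IndepFun (fun ω => G ω i j) (fun ω => G ω i' j) P :=
        h.indep_G.indepFun (i := (i, j)) (j := (i', j)) (by simpa using hii)
      rw [hi.integral_fun_mul_eq_mul_integral (h.meas_G i j).aestronglyMeasurable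
        (h.meas_G i' j).aestronglyMeasurable, h.mean_G, zero_mul]

theorem integral_sum_sources_mul [IsProbabilityMeasure P] (h : IsModel P K z G) (j : Fin n) (c d : Fin r ⊕ Fin p → ℝ) :
    ∫ ω, (∑ a, c a * sources (z ω) (G ω) j a) * ∑ b, d b * sources (z ω) (G ω) j b ∂P =
      (∑ k, c (.inl k) * d (.inl k)) + (n : ℝ)⁻¹ * ∑ i, c (.inr i) * d (.inr i) := by
  have hint : ∀ a b, Integrable (fun ω => (c a * sources (z ω) (G ω) j a) *
      (d b * sources (z ω) (G ω) j b)) P := fun a b =>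
    ((h.memLp_sources j a).const_mul (c a)).integrable_mul ((h.memLp_sources j b).const_mul (d b))
  simp only [Finset.sum_mul_sum]
  rw [integral_finsetSum _ fun a _ => integrable_finsetSum _ fun b _ => hint a b]
  have e : ∀ a, ∫ ω, ∑ b, (c a * sources (z ω) (G ω) j a) * (d b * sources (z ω) (G ω) j b) ∂P =
      c a * d a * Sum.elim (fun _ : Fin r => (1 : ℝ)) (fun _ : Fin p => (n : ℝ)⁻¹) a := by
    intro a
    rw [integral_finsetSum _ fun b _ => hint a b]
    simp only [mul_mul_mul_comm (c a), integral_const_mul, h.integral_sources_mul]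
    simp
  rw [Finset.sum_congr rfl fun a _ => e a]
  simp only [Fintype.sum_sum_type, Sum.elim_inl, Sum.elim_inr, mul_one, Finset.mul_sum]
  congr 1
  exact Finset.sum_congr rfl fun i _ => mul_comm _ _

variable {t : Fin r → ℝ} {u : Fin r → EuclideanSpace ℝ (Fin p)}

theorem integral_inner_col_observed_mul [IsProbabilityMeasure P] (h : IsModel P K z G) (j : Fin n) (x y : EuclideanSpace ℝ (Fin p)) :
    ∫ ω, inner ℝ x (col (signal t u (z ω) + G ω) j) *
      inner ℝ y (col (signal t u (z ω) + G ω) j) ∂P = populationCov t u x y := by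
  have hn : (n : ℝ) ≠ 0 := Nat.cast_ne_zero.2 (Nat.ne_of_gt j.pos)
  have hs := Real.mul_self_sqrt (Nat.cast_nonneg (α := ℝ) n)
  simp only [inner_col_observed, h.integral_sum_sources_mul]
  simp only [observedCoeff, Sum.elim_inl, Sum.elim_inr, populationCov_apply]
  rw [add_comm, inner_eq_sum, Finset.mul_sum]
  congr 1
  · refine Finset.sum_congr rfl fun i _ => ?_
    calc (n : ℝ)⁻¹ * (√n * x i * (√n * y i)) = (n : ℝ)⁻¹ * (√n * √n) * (x i * y i) := by ring
      _ = x i * y i := by rw [hs, inv_mul_cancel₀ hn, one_mul]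
  · refine Finset.sum_congr rfl fun k _ => ?_
    rw [real_inner_comm x, real_inner_comm y]
    ring

theorem integral_inner_col_signal_mul [IsProbabilityMeasure P] (h : IsModel P K z G) (j : Fin n) (x y : EuclideanSpace ℝ (Fin p)) :
    ∫ ω, inner ℝ x (col (signal t u (z ω)) j) *
      inner ℝ y (col (signal t u (z ω) + G ω) j) ∂P =
      ∑ k, t k ^ 2 * inner ℝ (u k) x * inner ℝ (u k) y := by
  simp only [inner_col_observed]
  simp only [fun ω => inner_col_signal t u (z ω) (G ω) x j]
  rw [h.integral_sum_sources_mul]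
  simp only [signalCoeff, observedCoeff, Sum.elim_inl, Sum.elim_inr, Pi.zero_apply, zero_mul,
    Finset.sum_const_zero, mul_zero, add_zero]
  refine Finset.sum_congr rfl fun k _ => ?_
  rw [real_inner_comm x, real_inner_comm y]
  ring

theorem measurable_inner_col_observed (h : IsModel P K z G) (j : Fin n) (x : EuclideanSpace ℝ (Fin p)) :
    Measurable fun ω => inner ℝ x (col (signal t u (z ω) + G ω) j) := by
  simp only [inner_col_observed]
  exact Finset.measurable_sum _ fun a _ => (h.measurable_sources j a).const_mul _

/-- The columns of the observed matrix are independent. -/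
theorem iIndepFun_inner_col_mul [IsProbabilityMeasure P] (h : IsModel P K z G) (x y : EuclideanSpace ℝ (Fin p)) (c : ℝ) :
    iIndepFun (fun j ω => inner ℝ x (col (signal t u (z ω) + G ω) j) *
      inner ℝ y (col (signal t u (z ω) + G ω) j) - c) P := by
  have hcols := iIndepFun.curry_right (f := fun i j ω => G ω i j) h.meas_G h.indep_G
  have hpairs := iIndepFun.prodMk_of_indepFun (f := fun j ω => z ω j)
    (g := fun j ω i => G ω i j) (fun j => measurable_pi_lambda _ (h.meas_z j))
    (fun j => measurable_pi_lambda _ fun i => h.meas_G i j) h.indep_z hcols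
    (h.indep_zG.comp (φ := id) (ψ := fun (x : Fin p → Fin n → ℝ) j i => x i j) measurable_id
      (by fun_prop))
  let L : EuclideanSpace ℝ (Fin p) → (Fin r → ℝ) × (Fin p → ℝ) → ℝ := fun x v =>
    ∑ a, observedCoeff n t u x a * Sum.elim v.1 v.2 a
  have hL : ∀ x, Measurable (L x) := fun x => by
    refine Finset.measurable_sum _ fun a _ => Measurable.const_mul ?_ _
    rcases a with k | i
    · exact (measurable_pi_apply k).comp measurable_fst
    · exact (measurable_pi_apply i).comp measurable_snd
  have := hpairs.comp (fun _ v => L x v * L y v - c) fun _ =>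
    ((hL x).mul (hL y)).sub_const c
  simp only [inner_col_observed]
  exact this

/-- The inner products of a column of the observed matrix with the vectors of the unit ball are
sub-Gaussian with the same parameter. -/
theorem hasSubgaussianMGF_inner_col [IsProbabilityMeasure P] (h : IsModel P K z G) (hu : Orthonormal ℝ u) (j : Fin n)
    {x : EuclideanSpace ℝ (Fin p)} (hx : ‖x‖ ≤ 1) :
    HasSubgaussianMGF (fun ω => inner ℝ x (col (signal t u (z ω) + G ω) j))
      (((∑ k, NNReal.sqrt (⟨t k ^ 2, sq_nonneg _⟩ * K)) + 1) ^ 2) P := by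
  have hn : (n : ℝ≥0) ≠ 0 := Nat.cast_ne_zero.2 (Nat.ne_of_gt j.pos)
  have hsignal : HasSubgaussianMGF (fun ω => ∑ k, (t k * inner ℝ x (u k)) * z ω j k)
      ((∑ k, NNReal.sqrt (⟨t k ^ 2, sq_nonneg _⟩ * K)) ^ 2) P := by
    refine HasSubgaussianMGF.finset_sum _ fun k => ?_
    refine HasSubgaussianMGF.mono ((h.subG_z j k).const_mul _) ?_
    refine mul_le_mul_of_nonneg_right ?_ K.2
    have hle : |inner ℝ x (u k)| ≤ 1 := by
      have := abs_real_inner_le_norm x (u k)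
      rw [hu.1, mul_one] at this
      exact this.trans hx
    show (t k * inner ℝ x (u k)) ^ 2 ≤ t k ^ 2
    rw [mul_pow]
    have := (sq_le_one_iff_abs_le_one _).2 hle
    nlinarith [sq_nonneg (t k)]
  have hnoise : HasSubgaussianMGF (fun ω => ∑ i, (√n * x i) * G ω i j) 1 P := by
    have hind : iIndepFun (fun i ω => (√n * x i) * G ω i j) P := by
      have h1 := h.indep_G.precomp (g := fun i => (i, j)) (Prod.mk_left_injective j)
      exact h1.comp (fun i v => (√n * x i) * v) fun i => measurable_const_mul _
    refine HasSubgaussianMGF.mono (HasSubgaussianMGF.sum_of_iIndepFun hind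
      fun i _ => (h.subG_G i j).const_mul _) ?_
    rw [← NNReal.coe_le_coe, NNReal.coe_sum]
    have hn' : (n : ℝ) ≠ 0 := by exact_mod_cast hn
    have e : ∀ i, (((⟨(√n * x i) ^ 2, sq_nonneg _⟩ * (n : ℝ≥0)⁻¹ : ℝ≥0)) : ℝ) = x i * x i := by
      intro i
      show (√n * x i) ^ 2 * (n : ℝ)⁻¹ = x i * x i
      rw [mul_pow, Real.sq_sqrt (Nat.cast_nonneg n)]
      field_simp
    rw [Finset.sum_congr rfl fun i _ => e i, ← inner_eq_sum, real_inner_self_eq_norm_sq]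
    exact pow_le_one₀ (norm_nonneg _) hx
  have hsum := hsignal.add hnoise
  rw [NNReal.sqrt_sq, NNReal.sqrt_one] at hsum
  simp only [inner_col_observed, Fintype.sum_sum_type]
  exact hsum

end IsModel

end Model

end SpikedModel

namespace SpikedModel

/-! ### Almost sure convergence of the sample covariance -/

section Covariance

variable {Ω : Type*} [MeasurableSpace Ω] {P : Measure Ω} [IsProbabilityMeasure P] {r : ℕ}

/-- The tail bound for the operator norm of the deviation of the sample covariance: Bernstein's
inequality for a pair of points, and a union bound over pairs of points of a net. -/
theorem exists_sampleCov_tail_bound (t : Fin r → ℝ) (K : ℝ≥0) {ε : ℝ} (hε : 0 < ε) :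
    ∃ c > 0, ∀ {Ω : Type*} [MeasurableSpace Ω] (P : Measure Ω) [IsProbabilityMeasure P] (p n : ℕ)
      (z : Ω → Fin n → Fin r → ℝ) (G : Ω → Matrix (Fin p) (Fin n) ℝ)
      (u : Fin r → EuclideanSpace ℝ (Fin p)), 0 < n → Orthonormal ℝ u → IsModel P K z G →
      P.real {ω | ε ≤ ‖sampleCov (signal t u (z ω) + G ω) - populationCov t u‖} ≤
        25 ^ p * (2 * Real.exp (-(c * n))) := by
  set κ : ℝ≥0 := ((∑ k, NNReal.sqrt (⟨t k ^ 2, sq_nonneg _⟩ * K)) + 1) ^ 2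
  have hκ : 0 < κ := by positivity
  have hκ' : (0 : ℝ) < κ := hκ
  obtain ⟨c, hc, hbound⟩ := exists_exp_tail_bound (a := (4 * κ : ℝ)⁻¹)
    (M := subgaussianSqBound * Real.exp subgaussianSqBound) (ε := ε / 8) (by positivity)
    (mul_pos subgaussianSqBound_pos (Real.exp_pos _)) (by positivity)
  refine ⟨c, hc, ?_⟩
  intro Ω _ P _ p n z G u hn hu h
  obtain ⟨N, hNcard, hN1, hN⟩ := exists_net_card_le (EuclideanSpace ℝ (Fin p))
  rw [finrank_euclideanSpace_fin] at hNcard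
  let η : EuclideanSpace ℝ (Fin p) → EuclideanSpace ℝ (Fin p) → Fin n → Ω → ℝ := fun x y j ω =>
    inner ℝ x (col (signal t u (z ω) + G ω) j) * inner ℝ y (col (signal t u (z ω) + G ω) j) -
      populationCov t u x y
  have hn' : (0 : ℝ) < n := Nat.cast_pos.2 hn
  have hdev : ∀ x y ω, (sampleCov (signal t u (z ω) + G ω) - populationCov t u) x y =
      (n : ℝ)⁻¹ * ∑ j, η x y j ω := by
    intro x y ω
    rw [sub_apply, sub_apply, sampleCov_apply]
    simp only [η, Finset.sum_sub_distrib, Finset.sum_const, Finset.card_univ, Fintype.card_fin,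
      nsmul_eq_mul]
    rw [mul_sub, inv_mul_cancel_left₀ hn'.ne']
  have hpair : ∀ x ∈ N, ∀ y ∈ N, P.real {ω | ε / 8 * n ≤ |∑ j, η x y j ω|} ≤
      2 * Real.exp (-(c * n)) := by
    intro x hx y hy
    have hexp : ∀ j, _ := fun j => integrable_exp_abs_mul_sub_integral hκ
      (h.hasSubgaussianMGF_inner_col (t := t) hu j (hN1 x hx))
      (h.hasSubgaussianMGF_inner_col (t := t) hu j (hN1 y hy))
    simp only [h.integral_inner_col_observed_mul] at hexp
    refine hbound P n (η x y) (fun j => ?_) (h.iIndepFun_inner_col_mul x y _) (fun j => ?_)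
      (fun j => (hexp j).1) (fun j => (hexp j).2)
    · exact ((h.measurable_inner_col_observed j x).mul
        (h.measurable_inner_col_observed j y)).sub_const _
    · have hint : Integrable (fun ω => inner ℝ x (col (signal t u (z ω) + G ω) j) *
          inner ℝ y (col (signal t u (z ω) + G ω) j)) P :=
        (h.memLp_inner_col_observed j x).integrable_mul (h.memLp_inner_col_observed j y)
      simp only [η]
      rw [integral_sub hint (integrable_const _), h.integral_inner_col_observed_mul]
      simp
  have hsub : {ω | ε ≤ ‖sampleCov (signal t u (z ω) + G ω) - populationCov t u‖} ⊆
      ⋃ xy ∈ N ×ˢ N, {ω | ε / 8 * n ≤ |∑ j, η xy.1 xy.2 j ω|} := by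
    intro ω hω
    by_contra hnot
    simp only [Set.mem_iUnion, Finset.mem_product, Set.mem_ofPred_eq, exists_prop, not_exists,
      not_and, not_le, Prod.forall] at hnot
    have := ContinuousLinearMap.opNorm_le_four_mul_of_net (N := (N : Set _))
      (fun x hx => by simpa using hN x hx)
      (sampleCov (signal t u (z ω) + G ω) - populationCov t u) (C := ε / 8) (by positivity) ?_
    · have hω' : ε ≤ ‖sampleCov (signal t u (z ω) + G ω) - populationCov t u‖ := hω
      linarith
    · intro x hx y hy
      rw [hdev, abs_mul, abs_of_pos (inv_pos.2 hn'), inv_mul_le_iff₀ hn', mul_comm]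
      exact (hnot x y ⟨hx, hy⟩).le
  calc _ ≤ P.real (⋃ xy ∈ N ×ˢ N, {ω | ε / 8 * n ≤ |∑ j, η xy.1 xy.2 j ω|}) :=
        measureReal_mono hsub (measure_ne_top _ _)
    _ ≤ ∑ xy ∈ N ×ˢ N, P.real {ω | ε / 8 * n ≤ |∑ j, η xy.1 xy.2 j ω|} :=
        measureReal_biUnion_finset_le _ _
    _ ≤ ∑ xy ∈ N ×ˢ N, 2 * Real.exp (-(c * n)) := Finset.sum_le_sum fun xy hxy =>
        hpair _ (Finset.mem_product.1 hxy).1 _ (Finset.mem_product.1 hxy).2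
    _ = (N.card * N.card : ℝ) * (2 * Real.exp (-(c * n))) := by
        rw [Finset.sum_const, Finset.card_product, nsmul_eq_mul]
        push_cast
        rfl
    _ ≤ (5 ^ p * 5 ^ p : ℝ) * (2 * Real.exp (-(c * n))) := by
        have : (N.card : ℝ) ≤ 5 ^ p := by exact_mod_cast hNcard
        gcongr
    _ = _ := by
        rw [← mul_pow]
        norm_num

/-- If `p / n → 0`, then the sample covariance converges to the population covariance in operator
norm, almost surely: the number of points of the nets is `exp (o(n))`, so that the tail bounds
are summable. -/
theorem ae_tendsto_sampleCov (t : Fin r → ℝ) {p : ℕ → ℕ}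
    (hp : Tendsto (fun n : ℕ => (p n : ℝ) / n) atTop (𝓝 0))
    {u : ∀ n : ℕ, Fin r → EuclideanSpace ℝ (Fin (p n))} (hu : ∀ n, Orthonormal ℝ (u n)) {K : ℝ≥0}
    {z : ∀ n : ℕ, Ω → Fin n → Fin r → ℝ} {G : ∀ n : ℕ, Ω → Matrix (Fin (p n)) (Fin n) ℝ}
    (h : ∀ n, IsModel P K (z n) (G n)) :
    ∀ᵐ ω ∂P, Tendsto (fun n =>
      ‖sampleCov (signal t (u n) (z n ω) + G n ω) - populationCov t (u n)‖) atTop (𝓝 0) := by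
  have key : ∀ m : ℕ, ∀ᵐ ω ∂P, ∀ᶠ n in atTop,
      ‖sampleCov (signal t (u n) (z n ω) + G n ω) - populationCov t (u n)‖ < 1 / ((m : ℝ) + 1) := by
    intro m
    obtain ⟨c, hc, hbound⟩ := exists_sampleCov_tail_bound t K (ε := 1 / ((m : ℝ) + 1))
      (by positivity)
    let s : ℕ → Set Ω := fun n => {ω | 1 / ((m : ℝ) + 1) ≤
      ‖sampleCov (signal t (u n) (z n ω) + G n ω) - populationCov t (u n)‖}
    have hlog : Tendsto (fun n : ℕ => (p n : ℝ) / n * Real.log 25) atTop (𝓝 0) := by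
      simpa using hp.mul_const (Real.log 25)
    have hle : ∀ᶠ n in atTop, ‖P.real (s n)‖ ≤ 2 * Real.exp (n * (-(c / 2))) := by
      filter_upwards [hlog.eventually (ge_mem_nhds (half_pos hc)), eventually_gt_atTop 0]
        with n hn hn0
      have hn' : (0 : ℝ) < n := Nat.cast_pos.2 hn0
      rw [Real.norm_of_nonneg measureReal_nonneg]
      refine (hbound P (p n) n (z n) (G n) (u n) hn0 (hu n) (h n)).trans ?_
      have hpn : (p n : ℝ) * Real.log 25 ≤ c / 2 * n := by
        rw [div_mul_eq_mul_div, div_le_iff₀ hn'] at hn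
        exact hn
      -- the cardinality of the squared net uses up at most half of the exponent
      have h25 : (25 : ℝ) ^ p n = Real.exp (p n * Real.log 25) := by
        rw [Real.exp_nat_mul, Real.exp_log (by norm_num)]
      rw [h25, mul_left_comm, ← Real.exp_add]
      gcongr
      linarith
    have hsum : Summable fun n => P.real (s n) :=
      Summable.of_norm_bounded_eventually_nat
        ((Real.summable_exp_nat_mul_iff.2 (by linarith)).mul_left 2) hle
    have hne : ∑' n, P (s n) ≠ ⊤ := by
      have := hsum.tsum_ofReal_ne_top
      simpa using this
    filter_upwards [ae_eventually_notMem hne] with ω hω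
    filter_upwards [hω] with n hn
    simpa [s] using hn
  filter_upwards [ae_all_iff.2 key] with ω hω
  rw [tendsto_order]
  refine ⟨fun a ha => Eventually.of_forall fun n => ha.trans_le (norm_nonneg
    (sampleCov (signal t (u n) (z n ω) + G n ω) - populationCov t (u n))), fun a ha => ?_⟩
  obtain ⟨m, hm⟩ := exists_nat_one_div_lt ha
  filter_upwards [hω m] with n hn using hn.trans hm

end Covariance

end SpikedModel

namespace SpikedModel

/-! ### The best linear predictor -/

section Predictor

variable {Ω : Type*} [MeasurableSpace Ω] {P : Measure Ω} {p : ℕ}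

theorem memLp_of_inner {X : Ω → EuclideanSpace ℝ (Fin p)}
    (h : ∀ x, MemLp (fun ω => inner ℝ x (X ω)) 2 P) : MemLp X 2 P := by
  refine MemLp.of_eval_piLp fun i => ?_
  simpa [EuclideanSpace.inner_single_left] using h (EuclideanSpace.single i 1)

/-- The residual of the best linear predictor is uncorrelated with the observation: the derivative
of the mean squared error vanishes in the direction of every map of rank one. -/
theorem IsBestLinearPredictor.integral_residual_mul {X Y : Ω → EuclideanSpace ℝ (Fin p)}
    {A : EuclideanSpace ℝ (Fin p) →L[ℝ] EuclideanSpace ℝ (Fin p)}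
    (hA : IsBestLinearPredictor P X Y A) (hX : MemLp X 2 P) (hY : MemLp Y 2 P)
    (a b : EuclideanSpace ℝ (Fin p)) :
    ∫ ω, inner ℝ b (X ω - A (Y ω)) * inner ℝ a (Y ω) ∂P = 0 := by
  have hR : MemLp (fun ω => X ω - A (Y ω)) 2 P := hX.sub (A.comp_memLp' hY)
  have haY : MemLp (fun ω => inner ℝ a (Y ω)) 2 P := hY.const_inner a
  have hbR : MemLp (fun ω => inner ℝ b (X ω - A (Y ω))) 2 P := hR.const_inner b
  have h1 : Integrable (fun ω => ‖X ω - A (Y ω)‖ ^ 2) P := hR.integrable_norm_pow two_ne_zero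
  have h2 : Integrable (fun ω => inner ℝ b (X ω - A (Y ω)) * inner ℝ a (Y ω)) P :=
    hbR.integrable_mul haY
  have h3 : Integrable (fun ω => inner ℝ a (Y ω) ^ 2) P := haY.integrable_sq
  set m := ∫ ω, inner ℝ b (X ω - A (Y ω)) * inner ℝ a (Y ω) ∂P
  set v := ∫ ω, inner ℝ a (Y ω) ^ 2 ∂P
  have hv : 0 ≤ v := integral_nonneg fun ω => sq_nonneg _
  have key : ∀ s : ℝ, 0 ≤ s ^ 2 * (‖b‖ ^ 2 * v) - 2 * s * m := by
    intro s
    have hmin := hA (Set.mem_univ (A + s • (innerSL ℝ a).smulRight b))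
    simp only [Set.mem_ofPred_eq] at hmin
    have hexp : ∀ ω, ‖X ω - (A + s • (innerSL ℝ a).smulRight b) (Y ω)‖ ^ 2 =
        ‖X ω - A (Y ω)‖ ^ 2 + (s ^ 2 * ‖b‖ ^ 2 * inner ℝ a (Y ω) ^ 2 -
          2 * s * (inner ℝ b (X ω - A (Y ω)) * inner ℝ a (Y ω))) := by
      intro ω
      have e : X ω - (A + s • (innerSL ℝ a).smulRight b) (Y ω) =
          (X ω - A (Y ω)) - (s * inner ℝ a (Y ω)) • b := by
        simp [sub_sub, mul_smul]
      rw [e, norm_sub_sq_real, real_inner_smul_right, norm_smul, mul_pow, Real.norm_eq_abs, sq_abs,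
        real_inner_comm b]
      ring
    have h4 : Integrable (fun ω => s ^ 2 * ‖b‖ ^ 2 * inner ℝ a (Y ω) ^ 2 -
        2 * s * (inner ℝ b (X ω - A (Y ω)) * inner ℝ a (Y ω))) P :=
      (h3.const_mul _).sub (h2.const_mul _)
    simp only [hexp] at hmin
    rw [integral_add h1 h4,
      integral_sub (h3.const_mul _) (h2.const_mul _), integral_const_mul, integral_const_mul] at hmin
    linarith
  by_contra hm
  -- the quadratic in `s` is negative at `m / (w + 1)`, which makes sense also for `w = 0`
  set w := ‖b‖ ^ 2 * v
  have hw : 0 ≤ w := by positivity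
  have h := key (m / (w + 1))
  have hw1 : 0 < w + 1 := by linarith
  have e : (m / (w + 1)) ^ 2 * w - 2 * (m / (w + 1)) * m = -(m ^ 2 * (w + 2)) / (w + 1) ^ 2 := by
    field_simp
    ring
  rw [e] at h
  have : -(m ^ 2 * (w + 2)) / (w + 1) ^ 2 < 0 := by
    apply div_neg_of_neg_of_pos
    · have : 0 < m ^ 2 := by positivity
      nlinarith
    · positivity
  linarith

/-- The best linear predictor shrinks the `k`-th principal component by the factor
`tₖ² / (1 + tₖ²)`, and annihilates the orthogonal complement of the principal components. -/
theorem IsBestLinearPredictor.apply_eq [IsProbabilityMeasure P] {n r : ℕ} {K : ℝ≥0}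
    {z : Ω → Fin n → Fin r → ℝ} {G : Ω → Matrix (Fin p) (Fin n) ℝ} (h : IsModel P K z G)
    {t : Fin r → ℝ} {u : Fin r → EuclideanSpace ℝ (Fin p)} (hu : Orthonormal ℝ u) (j : Fin n)
    {A : EuclideanSpace ℝ (Fin p) →L[ℝ] EuclideanSpace ℝ (Fin p)}
    (hA : IsBestLinearPredictor P (fun ω => col (signal t u (z ω)) j)
      (fun ω => col (signal t u (z ω) + G ω) j) A) (y : EuclideanSpace ℝ (Fin p)) :
    A y = ∑ k, (t k ^ 2 / (1 + t k ^ 2) * inner ℝ (u k) y) • u k := by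
  have hcov : ∀ a b, ∑ k, t k ^ 2 * inner ℝ (u k) b * inner ℝ (u k) a =
      inner ℝ b (A a) + ∑ k, t k ^ 2 * inner ℝ b (A (u k)) * inner ℝ (u k) a := by
    intro a b
    have h1 := hA.integral_residual_mul (memLp_of_inner (h.memLp_inner_col_signal j))
      (memLp_of_inner (h.memLp_inner_col_observed j)) a b
    have hsplit : ∀ ω, inner ℝ b (col (signal t u (z ω)) j -
        A (col (signal t u (z ω) + G ω) j)) * inner ℝ a (col (signal t u (z ω) + G ω) j) =
        inner ℝ b (col (signal t u (z ω)) j) * inner ℝ a (col (signal t u (z ω) + G ω) j) -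
        inner ℝ (A.adjoint b) (col (signal t u (z ω) + G ω) j) *
          inner ℝ a (col (signal t u (z ω) + G ω) j) := by
      intro ω
      rw [inner_sub_right, sub_mul, A.adjoint_inner_left]
    simp only [hsplit] at h1
    have h2 : Integrable (fun ω => inner ℝ b (col (signal t u (z ω)) j) *
        inner ℝ a (col (signal t u (z ω) + G ω) j)) P :=
      (h.memLp_inner_col_signal j b).integrable_mul (h.memLp_inner_col_observed j a)
    have h3 : Integrable (fun ω => inner ℝ (A.adjoint b) (col (signal t u (z ω) + G ω) j) *
        inner ℝ a (col (signal t u (z ω) + G ω) j)) P :=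
      (h.memLp_inner_col_observed j _).integrable_mul (h.memLp_inner_col_observed j a)
    rw [integral_sub h2 h3, h.integral_inner_col_signal_mul,
      h.integral_inner_col_observed_mul, sub_eq_zero, populationCov_apply,
      A.adjoint_inner_left] at h1
    rw [h1]
    simp only [real_inner_comm (A.adjoint b), A.adjoint_inner_left]
  have hcomp : ∀ l b, (1 + t l ^ 2) * inner ℝ b (A (u l)) = t l ^ 2 * inner ℝ (u l) b := by
    intro l b
    have := hcov (u l) b
    simp only [orthonormal_iff_ite.1 hu] at this
    simp only [mul_ite, mul_one, mul_zero, Finset.sum_ite_eq', Finset.mem_univ, if_true] at this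
    linarith
  refine ext_inner_left ℝ fun b => ?_
  have hA' : inner ℝ b (A y) =
      ∑ k, t k ^ 2 * (inner ℝ (u k) b - inner ℝ b (A (u k))) * inner ℝ (u k) y := by
    have := hcov y b
    simp only [mul_sub, sub_mul, Finset.sum_sub_distrib]
    linarith
  rw [hA', inner_sum]
  refine Finset.sum_congr rfl fun k _ => ?_
  have hk : (1 + t k ^ 2) ≠ 0 := by positivity
  have := hcomp k b
  have e : inner ℝ b (A (u k)) = t k ^ 2 * inner ℝ (u k) b / (1 + t k ^ 2) := by
    rw [eq_div_iff hk]
    linarith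
  rw [e, real_inner_smul_right, real_inner_comm b]
  field_simp
  ring

end Predictor

/-! ### Columns and matrices -/

theorem ofCols_eq_linearShrink {p n r : ℕ} {t : Fin r → ℝ} {u : Fin r → EuclideanSpace ℝ (Fin p)}
    {A : Fin n → EuclideanSpace ℝ (Fin p) →L[ℝ] EuclideanSpace ℝ (Fin p)}
    (hA : ∀ j y, A j y = ∑ k, (t k ^ 2 / (1 + t k ^ 2) * inner ℝ (u k) y) • u k)
    (Y : Matrix (Fin p) (Fin n) ℝ) :
    ofCols (fun j => A j (col Y j)) = linearShrink t u Y := by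
  ext i j
  have hn : √(n : ℝ) ≠ 0 := (Real.sqrt_pos.2 (Nat.cast_pos.2 j.pos)).ne'
  simp only [ofCols, linearShrink, Matrix.of_apply, hA, inner_col, WithLp.ofLp_sum,
    WithLp.ofLp_smul, Finset.sum_apply, Pi.smul_apply, smul_eq_mul, Finset.sum_div]
  refine Finset.sum_congr rfl fun k _ => ?_
  field_simp

/-- The average squared distance between the columns of `M` and the vectors `xⱼ` is the squared
Frobenius distance between `M` and `[x₁, …, xₙ] / √n`. -/
theorem average_norm_col_sub_sq {p n : ℕ} (M : Matrix (Fin p) (Fin n) ℝ)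
    (x : Fin n → EuclideanSpace ℝ (Fin p)) :
    (1 / (n : ℝ)) * ∑ j, ‖col M j - x j‖ ^ 2 = ‖M - ofCols x‖ ^ 2 := by
  rw [frobenius_norm_sq, Finset.sum_comm, Finset.mul_sum]
  refine Finset.sum_congr rfl fun j _ => ?_
  have hn : (0 : ℝ) < n := Nat.cast_pos.2 j.pos
  have hs : √(n : ℝ) ≠ 0 := (Real.sqrt_pos.2 hn).ne'
  have hs2 : √(n : ℝ) ^ 2 = n := Real.sq_sqrt hn.le
  rw [EuclideanSpace.real_norm_sq_eq, Finset.mul_sum]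
  refine Finset.sum_congr rfl fun i _ => ?_
  simp only [col, ofCols, Matrix.sub_apply, Matrix.of_apply, PiLp.sub_apply]
  have e : √(n : ℝ) * M i j - x j i = √n * (M i j - x j i / √n) := by
    field_simp
  rw [e, mul_pow, hs2]
  field_simp

end SpikedModel

theorem theorem4p1 {Ω : Type*} [MeasurableSpace Ω] (P : Measure Ω) [IsProbabilityMeasure P]
    {r : ℕ} (t : Fin r → ℝ) (ht_pos : ∀ k, 0 < t k) (ht_anti : StrictAnti t)
    (p : ℕ → ℕ) (hp : Tendsto (fun n : ℕ => (p n : ℝ) / n) atTop (𝓝 0))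
    -- the principal components
    (u : ∀ n : ℕ, Fin r → EuclideanSpace ℝ (Fin (p n))) (hu : ∀ n, Orthonormal ℝ (u n))
    -- the coefficients: iid over the columns, centered, uncorrelated of unit variance, sub-Gaussian
    (z : ∀ n : ℕ, Ω → Fin n → Fin r → ℝ)
    (hz_meas : ∀ n j k, Measurable fun ω => z n ω j k)
    (hz_indep : ∀ n, iIndepFun (fun (j : Fin n) ω => z n ω j) P)
    (hz_ident : ∀ n (j j' : Fin n), IdentDistrib (fun ω => z n ω j) (fun ω => z n ω j') P P)
    (hz_mean : ∀ n j k, ∫ ω, z n ω j k ∂P = 0)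
    (hz_cov : ∀ n j k l, ∫ ω, z n ω j k * z n ω j l ∂P = if k = l then 1 else 0)
    (K : ℝ≥0) (hz_subG : ∀ n j k, HasSubgaussianMGF (fun ω => z n ω j k) K P)
    -- the noise: iid N(0, 1/n) entries, independent of the signal
    (G : ∀ n : ℕ, Ω → Matrix (Fin (p n)) (Fin n) ℝ)
    (hG_meas : ∀ n i j, Measurable fun ω => G n ω i j)
    (hG_law : ∀ n i j, P.map (fun ω => G n ω i j) = gaussianReal 0 ((n : ℝ≥0)⁻¹))
    (hG_indep : ∀ n, iIndepFun (fun (ij : Fin (p n) × Fin n) ω => G n ω ij.1 ij.2) P)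
    (hzG_indep : ∀ n, IndepFun (fun ω j k => z n ω j k) (fun ω i j => G n ω i j) P)
    -- the signal matrix and the observed matrix
    (X Y : ∀ n : ℕ, Ω → Matrix (Fin (p n)) (Fin n) ℝ)
    (hX : ∀ n ω, X n ω = SpikedModel.signal t (u n) (z n ω))
    (hY : ∀ n ω, Y n ω = X n ω + G n ω)
    -- a singular value decomposition of the observed matrix
    (S : ∀ (n : ℕ) (ω : Ω), SpikedModel.SVD (Y n ω))
    -- the best linear predictor of each column
    (A : ∀ n : ℕ, Fin n → EuclideanSpace ℝ (Fin (p n)) →L[ℝ] EuclideanSpace ℝ (Fin (p n)))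
    (hA : ∀ n j, SpikedModel.IsBestLinearPredictor P
      (fun ω => SpikedModel.col (X n ω) j) (fun ω => SpikedModel.col (Y n ω) j) (A n j)) :
    -- the optimal singular values in the limit of aspect ratio 0
    (∀ q : Fin r → ℝ, (∀ k, SpikedModel.IsOptimal 0 (t k) (q k)) →
      ∀ᵐ ω ∂P,
        Tendsto (fun n : ℕ => (1 / (n : ℝ)) * ∑ j : Fin n,
          ‖SpikedModel.col ((S n ω).shrink q) j - A n j (SpikedModel.col (Y n ω) j)‖ ^ 2)
          atTop (𝓝 0) ∧
        Tendsto (fun n : ℕ => ‖(S n ω).shrink q -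
            SpikedModel.ofCols (fun j => A n j (SpikedModel.col (Y n ω) j))‖ ^ 2)
          atTop (𝓝 0)) ∧
    -- the optimal singular values estimated from the observed ones, with aspect ratio p / n
    (∀ q : ℕ → Ω → Fin r → ℝ,
      (∀ n ω (k : Fin r), SpikedModel.IsOptimal ((p n : ℝ) / n)
        (SpikedModel.estimateStrength ((p n : ℝ) / n) ((S n ω).singularValue k)) (q n ω k)) →
      ∀ᵐ ω ∂P,
        Tendsto (fun n : ℕ => (1 / (n : ℝ)) * ∑ j : Fin n,
          ‖SpikedModel.col ((S n ω).shrink (q n ω)) j -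
            A n j (SpikedModel.col (Y n ω) j)‖ ^ 2)
          atTop (𝓝 0) ∧
        Tendsto (fun n : ℕ => ‖(S n ω).shrink (q n ω) -
            SpikedModel.ofCols (fun j => A n j (SpikedModel.col (Y n ω) j))‖ ^ 2)
          atTop (𝓝 0)) := by
  have hmodel : ∀ n, SpikedModel.IsModel P K (z n) (G n) := fun n =>
    ⟨hz_meas n, hz_indep n, hz_mean n, hz_cov n, hz_subG n, hG_meas n, hG_law n, hG_indep n,
      hzG_indep n⟩
  have hYeq : ∀ n ω, Y n ω = SpikedModel.signal t (u n) (z n ω) + G n ω := fun n ω => by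
    rw [hY, hX]
  have hAeq : ∀ n j y, A n j y =
      ∑ k, (t k ^ 2 / (1 + t k ^ 2) * inner ℝ (u n k) y) • u n k := by
    intro n j
    refine SpikedModel.IsBestLinearPredictor.apply_eq (hmodel n) (hu n) j ?_
    have := hA n j
    simp only [hYeq, hX] at this
    exact this
  have hcov : ∀ᵐ ω ∂P, Tendsto (fun n => ‖SpikedModel.sampleCov (Y n ω) -
      SpikedModel.populationCov t (u n)‖) atTop (𝓝 0) := by
    simp only [hYeq]
    exact SpikedModel.ae_tendsto_sampleCov t hp hu hmodel
  have main : ∀ q : ℕ → Ω → Fin r → ℝ, ∀ ω,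
      Tendsto (fun n => ‖SpikedModel.sampleCov (Y n ω) -
        SpikedModel.populationCov t (u n)‖) atTop (𝓝 0) →
      (∀ k, Tendsto (fun n => q n ω k) atTop (𝓝 (t k ^ 2 / √(1 + t k ^ 2)))) →
        Tendsto (fun n : ℕ => (1 / (n : ℝ)) * ∑ j : Fin n,
          ‖SpikedModel.col ((S n ω).shrink (q n ω)) j -
            A n j (SpikedModel.col (Y n ω) j)‖ ^ 2)
          atTop (𝓝 0) ∧
        Tendsto (fun n : ℕ => ‖(S n ω).shrink (q n ω) -
            SpikedModel.ofCols (fun j => A n j (SpikedModel.col (Y n ω) j))‖ ^ 2)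
          atTop (𝓝 0) := by
    intro q ω hω hq
    have h := SpikedModel.tendsto_norm_shrink_sub_linearShrink ht_pos ht_anti hu
      (fun n => S n ω) hω hq
    have h2 : Tendsto (fun n : ℕ => ‖(S n ω).shrink (q n ω) -
        SpikedModel.ofCols (fun j => A n j (SpikedModel.col (Y n ω) j))‖ ^ 2) atTop (𝓝 0) := by
      simp only [SpikedModel.ofCols_eq_linearShrink (hAeq _)]
      simpa using h.pow 2
    refine ⟨?_, h2⟩
    simp only [SpikedModel.average_norm_col_sub_sq]
    exact h2
  refine ⟨fun q hq => ?_, fun q hq => ?_⟩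
  · filter_upwards [hcov] with ω hω
    exact main (fun _ _ => q) ω hω fun k => SpikedModel.tendsto_of_isOptimal (ht_pos k)
      tendsto_const_nhds tendsto_const_nhds fun _ => hq k
  · filter_upwards [hcov] with ω hω
    exact main q ω hω fun k => SpikedModel.tendsto_of_isOptimal (ht_pos k) hp
      (SpikedModel.tendsto_estimateStrength (ht_pos k) hp
        (SpikedModel.tendsto_singularValue ht_pos ht_anti hu (fun n => S n ω) hω k))
      fun n => hq n ω k
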